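/- Let $n \ge 2$, let $W \subseteq \mathbb{C}^{n+1}$ be open and let $f$ be holomorphic on $W$ (for instance $f=P/Q$ rational, with $W=\{Q\neq 0\}$). Consider the scalar ODE $$y^{(n)} + f(x, y, y', \dots, y^{(n-1)}) = 0 .$$ Let $U \subseteq \mathbb{C}^2$ be a connected open set such that $W$ contains a point $(x,y,y',\dots,y^{(n-1)})$ with $(x,y)\in U$. An infinitesimal point symmetry over $U$ is a holomorphic vector field $X=\xi(x,y)\,\partial_x+\eta(x,y)\,\partial_y$ on $U$ such that $$\Big(\xi\,\partial_x+\sum_{k=0}^{n}\eta^{(k)}\,\partial_{y^{(k)}}\Big)\big(y^{(n)}+f\big)=0 \quad\text{whenever}\quad y^{(n)}+f=0,$$ at all $(x,y,\dots,y^{(n)})$ with $(x,y)\in U$ and $(x,y,\dots,y^{(n-1)})\in W$, where $\eta^{(0)}=\eta$, $\eta^{(k)}=D_x\eta^{(k-1)}-y^{(k)}D_x\xi$ and $D_x=\partial_x+\sum_{k\ge 0}y^{(k+1)}\partial_{y^{(k)}}$. These vector fields form a Lie algebra over $\mathbb{C}$ under the Lie bracket. This point symmetry algebra is finite-dimensional;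 for $n=2$ its dimension is at most $8$. -/

import Mathlib

open scoped Topology

noncomputable section

theorem analyticAt_fderiv_apply {A B : Type*} [NormedAddCommGroup A] [NormedSpace ℂ A]
    [NormedAddCommGroup B] [NormedSpace ℂ B] [CompleteSpace B] {g : A → B} {V : A → A} {a : A}
    (hg : AnalyticAt ℂ g a) (hV : AnalyticAt ℂ V a) :
    AnalyticAt ℂ (fun i => fderiv ℂ g i (V i)) a :=
  AnalyticAt.comp₂ (h := fun q : (A →L[ℂ] B) × A => q.1 q.2)
    ((ContinuousLinearMap.apply ℂ B).flip.analyticAt_bilinear _) hg.fderiv hV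

/-- Jets of order `n` of a scalar function `y(x)`: `(x, (y, y', …, y⁽ⁿ⁾))`. -/
abbrev Jet (n : ℕ) : Type := ℂ × (Fin (n + 1) → ℂ)

/-- The coordinate `y⁽ᵏ⁾` on `Jet n` (for `k ≤ n`; zero for larger `k`). -/
def yCoord {n : ℕ} (j : Jet n) (k : ℕ) : ℂ :=
  if h : k < n + 1 then j.2 ⟨k, h⟩ else 0

/-- The underlying point `(x, y)` of a jet. -/
def jetBase {n : ℕ} (j : Jet n) : ℂ × ℂ := (j.1, j.2 0)

/-- The truncated jet `(x, (y, …, y⁽ⁿ⁻¹⁾))`. -/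
def jetLower {n : ℕ} (j : Jet n) : ℂ × (Fin n → ℂ) := (j.1, fun k => j.2 k.castSucc)

/-- The direction of the total derivative: `x ↦ 1`, `y⁽ᵏ⁾ ↦ y⁽ᵏ⁺¹⁾`. -/
def totalDir {n : ℕ} (j : Jet n) : Jet n := (1, fun k => yCoord j (k + 1))

/-- The total derivative `D_x = ∂_x + ∑ y⁽ᵏ⁺¹⁾ ∂_{y⁽ᵏ⁾}` on functions on `Jet n` which depend only
on `x, y, …, y⁽ⁿ⁻¹⁾` (the only functions to which it is applied in forming `η⁽ᵏ⁾` for `k ≤ n`). -/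
def totalDeriv {n : ℕ} (g : Jet n → ℂ) (j : Jet n) : ℂ := fderiv ℂ g j (totalDir j)

/-- For `X = (ξ, η)`: the coefficients `η⁽⁰⁾ = η`, `η⁽ᵏ⁺¹⁾ = D_x η⁽ᵏ⁾ - y⁽ᵏ⁺¹⁾ D_x ξ`. -/
def prolongCoeff {n : ℕ} (X : ℂ × ℂ → ℂ × ℂ) : ℕ → Jet n → ℂ
  | 0 => fun j => (X (jetBase j)).2
  | k + 1 => fun j => totalDeriv (prolongCoeff X k) j -
      yCoord j (k + 1) * totalDeriv (fun i => (X (jetBase i)).1) j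

/-- The symmetry operator `ξ ∂_x + ∑_{k ≤ n} η⁽ᵏ⁾ ∂_{y⁽ᵏ⁾}`, as a vector field on `Jet n`. -/
def prolong {n : ℕ} (X : ℂ × ℂ → ℂ × ℂ) (j : Jet n) : Jet n :=
  ((X (jetBase j)).1, fun k => prolongCoeff X k j)

/-- A scalar ODE `y⁽ⁿ⁾ + f(x, y, …, y⁽ⁿ⁻¹⁾) = 0` with `f` holomorphic on an open set `dom`.
For a rational `f = P / Q`, `dom` is the set where `Q ≠ 0`. -/
structure ScalarODE (n : ℕ) where
  dom : TopologicalSpace.Opens (ℂ × (Fin n → ℂ))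
  f : ℂ × (Fin n → ℂ) → ℂ
  holo : AnalyticOnNhd ℂ f dom

/-- The left-hand side `y⁽ⁿ⁾ + f(x, y, …, y⁽ⁿ⁻¹⁾)`. -/
def ScalarODE.lhs {n : ℕ} (E : ScalarODE n) (j : Jet n) : ℂ :=
  j.2 (Fin.last n) + E.f (jetLower j)

/-- The invariance condition: the symmetry operator applied to the left-hand side of the equation
vanishes wherever the equation holds (at the jets over `U` at which `f` is defined). -/
def IsPointSymmetry {n : ℕ} (E : ScalarODE n) (U : Set (ℂ × ℂ)) (X : ℂ × ℂ → ℂ × ℂ) : Prop :=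
  ∀ j : Jet n, jetBase j ∈ U → jetLower j ∈ E.dom → E.lhs j = 0 →
    fderiv ℂ E.lhs j (prolong X j) = 0

/-- Holomorphic vector fields `X = ξ ∂_x + η ∂_y` on `U ⊆ ℂ²`, represented by the pair
`(ξ, η)`, extended by zero outside `U`. -/
def holVectorFields (U : TopologicalSpace.Opens (ℂ × ℂ)) : Submodule ℂ (ℂ × ℂ → ℂ × ℂ) where
  carrier := {X | AnalyticOnNhd ℂ X U ∧ ∀ p ∉ U, X p = 0}
  add_mem' := fun {X Y} hX hY => ⟨hX.1.add hY.1, fun p hp => by simp [hX.2 p hp, hY.2 p hp]⟩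
  zero_mem' := ⟨analyticOnNhd_const, fun _ _ => rfl⟩
  smul_mem' := fun c X hX =>
    ⟨(analyticOnNhd_const (v := c)).smul hX.1, fun p hp => by simp [hX.2 p hp]⟩

/-- The type of holomorphic vector fields on `U`. -/
def HolVectorField (U : TopologicalSpace.Opens (ℂ × ℂ)) : Type := holVectorFields U

namespace HolVectorField

variable {U : TopologicalSpace.Opens (ℂ × ℂ)}

instance : AddCommGroup (HolVectorField U) := inferInstanceAs (AddCommGroup (holVectorFields U))

instance : Module ℂ (HolVectorField U) := inferInstanceAs (Module ℂ (holVectorFields U))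

theorem analytic (X : HolVectorField U) : AnalyticOnNhd ℂ X.1 U := X.2.1

theorem contDiffAt (X : HolVectorField U) {p : ℂ × ℂ} (hp : p ∈ U) (m : WithTop ℕ∞) :
    ContDiffAt ℂ m X.1 p := (X.analytic p hp).contDiffAt

theorem diffAt (X : HolVectorField U) {p : ℂ × ℂ} (hp : p ∈ U) :
    DifferentiableAt ℂ X.1 p := (X.analytic p hp).differentiableAt

/-- The Lie bracket of vector fields. -/
instance : Bracket (HolVectorField U) (HolVectorField U) where
  bracket X Y := ⟨VectorField.lieBracket ℂ X.1 Y.1, by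
    refine ⟨?_, fun p hp =>
      VectorField.lieBracket_eq_zero_of_eq_zero (X.2.2 p hp) (Y.2.2 p hp)⟩
    intro p hp
    have hX := X.analytic p hp
    have hY := Y.analytic p hp
    exact (analyticAt_fderiv_apply hY hX).sub (analyticAt_fderiv_apply hX hY)⟩

theorem ext' {X Y : HolVectorField U} (h : ∀ p ∈ U, X.1 p = Y.1 p) : X = Y := by
  refine Subtype.ext (funext fun p => ?_)
  by_cases hp : p ∈ U
  · exact h p hp
  · rw [X.2.2 p hp, Y.2.2 p hp]

theorem bracket_val (X Y : HolVectorField U) : (⁅X, Y⁆).1 = VectorField.lieBracket ℂ X.1 Y.1 := rfl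

theorem add_val (X Y : HolVectorField U) : (X + Y).1 = X.1 + Y.1 := rfl

theorem smul_val (c : ℂ) (X : HolVectorField U) : (c • X).1 = c • X.1 := rfl

theorem zero_val : (0 : HolVectorField U).1 = 0 := rfl

instance : LieRing (HolVectorField U) where
  add_lie X Y Z := ext' fun p hp => by
    simp only [bracket_val, add_val]
    exact VectorField.lieBracket_add_left (X.diffAt hp) (Y.diffAt hp)
  lie_add X Y Z := ext' fun p hp => by
    simp only [bracket_val, add_val]
    exact VectorField.lieBracket_add_right (Y.diffAt hp) (Z.diffAt hp)
  lie_self X := ext' fun p hp => by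
    simp only [bracket_val, VectorField.lieBracket_self, zero_val]
  leibniz_lie X Y Z := ext' fun p hp => by
    simp only [bracket_val, add_val]
    exact VectorField.leibniz_identity_lieBracket (n := 2) (by simp)
      (X.contDiffAt hp 2) (Y.contDiffAt hp 2) (Z.contDiffAt hp 2)

instance : LieAlgebra ℂ (HolVectorField U) where
  lie_smul c X Y := ext' fun p hp => by
    simp only [bracket_val, smul_val]
    exact VectorField.lieBracket_const_smul_right (Y.diffAt hp)

end HolVectorField

section Prolongation

variable {n : ℕ}

/-- `jetBase` as a continuous linear map. -/
def jetBaseL (n : ℕ) : Jet n →L[ℂ] ℂ × ℂ :=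
  (ContinuousLinearMap.fst ℂ ℂ (Fin (n + 1) → ℂ)).prod
    ((ContinuousLinearMap.proj 0).comp (ContinuousLinearMap.snd ℂ ℂ (Fin (n + 1) → ℂ)))

theorem jetBaseL_apply (j : Jet n) : jetBaseL n j = jetBase j := rfl

/-- `jetLower` as a continuous linear map. -/
def jetLowerL (n : ℕ) : Jet n →L[ℂ] ℂ × (Fin n → ℂ) :=
  (ContinuousLinearMap.fst ℂ ℂ (Fin (n + 1) → ℂ)).prod
    ((ContinuousLinearMap.pi fun k => ContinuousLinearMap.proj k.castSucc).comp
      (ContinuousLinearMap.snd ℂ ℂ (Fin (n + 1) → ℂ)))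

theorem jetLowerL_apply (j : Jet n) : jetLowerL n j = jetLower j := rfl

/-- `yCoord` as a continuous linear map. -/
def yCoordL (n k : ℕ) : Jet n →L[ℂ] ℂ :=
  if h : k < n + 1 then
    (ContinuousLinearMap.proj (⟨k, h⟩ : Fin (n + 1))).comp
      (ContinuousLinearMap.snd ℂ ℂ (Fin (n + 1) → ℂ))
  else 0

theorem yCoordL_apply (k : ℕ) (j : Jet n) : yCoordL n k j = yCoord j k := by
  unfold yCoordL yCoord
  split_ifs <;> rfl

/-- The linear part of `totalDir`. -/
def shiftL (n : ℕ) : Jet n →L[ℂ] Jet n :=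
  (0 : Jet n →L[ℂ] ℂ).prod (ContinuousLinearMap.pi fun k => yCoordL n (k + 1))

theorem totalDir_eq (j : Jet n) : totalDir j = (1, 0) + shiftL n j := by
  ext k
  · simp [totalDir, shiftL]
  · simp [totalDir, shiftL, yCoordL_apply]

theorem hasFDerivAt_totalDir (j : Jet n) : HasFDerivAt totalDir (shiftL n) j := by
  have : (totalDir : Jet n → Jet n) = fun j => (1, 0) + shiftL n j := funext totalDir_eq
  rw [this]
  exact (shiftL n).hasFDerivAt.const_add _

theorem analyticAt_totalDir (j : Jet n) : AnalyticAt ℂ (totalDir : Jet n → Jet n) j := by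
  have : (totalDir : Jet n → Jet n) = fun j => (1, 0) + shiftL n j := funext totalDir_eq
  rw [this]
  exact analyticAt_const.add ((shiftL n).analyticAt j)

theorem analyticAt_totalDeriv {g : Jet n → ℂ} {j : Jet n} (hg : AnalyticAt ℂ g j) :
    AnalyticAt ℂ (totalDeriv g) j :=
  analyticAt_fderiv_apply hg (analyticAt_totalDir j)

theorem analyticAt_xi {X : ℂ × ℂ → ℂ × ℂ} {j : Jet n} (hX : AnalyticAt ℂ X (jetBase j)) :
    AnalyticAt ℂ (fun i : Jet n => (X (jetBase i)).1) j := by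
  have h : AnalyticAt ℂ (fun i : Jet n => X (jetBase i)) j :=
    AnalyticAt.comp (f := fun i : Jet n => jetBase i) hX ((jetBaseL n).analyticAt j)
  exact analyticAt_fst.comp h

theorem analyticAt_prolongCoeff {X : ℂ × ℂ → ℂ × ℂ} {j : Jet n}
    (hX : AnalyticAt ℂ X (jetBase j)) (k : ℕ) :
    AnalyticAt ℂ (prolongCoeff X k : Jet n → ℂ) j := by
  induction k with
  | zero =>
    have h : AnalyticAt ℂ (fun i : Jet n => X (jetBase i)) j :=
      AnalyticAt.comp (f := fun i : Jet n => jetBase i) hX ((jetBaseL n).analyticAt j)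
    exact analyticAt_snd.comp h
  | succ k ih =>
    have hy : AnalyticAt ℂ (fun i : Jet n => yCoord i (k + 1)) j := by
      simpa only [← yCoordL_apply] using (yCoordL n (k + 1)).analyticAt j
    exact (analyticAt_totalDeriv ih).sub (hy.mul (analyticAt_totalDeriv (analyticAt_xi hX)))

theorem hasFDerivAt_yCoord (k : ℕ) (j : Jet n) :
    HasFDerivAt (fun i : Jet n => yCoord i k) (yCoordL n k) j := by
  simpa only [← yCoordL_apply] using (yCoordL n k).hasFDerivAt

theorem analyticAt_prolong {X : ℂ × ℂ → ℂ × ℂ} {j : Jet n}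
    (hX : AnalyticAt ℂ X (jetBase j)) : AnalyticAt ℂ (prolong X : Jet n → Jet n) j :=
  (analyticAt_xi hX).prod (AnalyticAt.pi fun k => analyticAt_prolongCoeff hX k)

/-- Directions in which `x, y, …, y⁽ᵏ⁾` do not change. -/
def IsHigh (k : ℕ) (v : Jet n) : Prop := v.1 = 0 ∧ ∀ i ≤ k, yCoord v i = 0

theorem fderiv_high {g : Jet n → ℂ} {v : Jet n} (h : ∀ (c : ℂ) (i : Jet n), g (i + c • v) = g i)
    (j : Jet n) : fderiv ℂ g j v = 0 := by
  by_cases hg : DifferentiableAt ℂ g j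
  · rw [← hg.lineDeriv_eq_fderiv]
    simp [lineDeriv, h]
  · simp [fderiv_zero_of_not_differentiableAt hg]

theorem IsHigh.smul {k : ℕ} {v : Jet n} (hv : IsHigh k v) (c : ℂ) : IsHigh k (c • v) := by
  refine ⟨by simp [hv.1], fun i hi => ?_⟩
  rw [← yCoordL_apply, map_smul, yCoordL_apply, hv.2 i hi, smul_zero]

theorem IsHigh.mono {k l : ℕ} {v : Jet n} (hv : IsHigh l v) (h : k ≤ l) : IsHigh k v :=
  ⟨hv.1, fun i hi => hv.2 i (hi.trans h)⟩

theorem IsHigh.shift {k : ℕ} {v : Jet n} (hv : IsHigh (k + 1) v) : IsHigh k (shiftL n v) := by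
  refine ⟨rfl, fun i hi => ?_⟩
  unfold yCoord
  split_ifs with h
  · have : (shiftL n v).2 ⟨i, h⟩ = yCoordL n (i + 1) v := rfl
    rw [this, yCoordL_apply]
    exact hv.2 _ (by omega)
  · rfl

theorem IsHigh.jetBase_add {k : ℕ} {v : Jet n} (hv : IsHigh k v) (j : Jet n) :
    jetBase (j + v) = jetBase j := by
  have h0 : v.2 0 = 0 := by simpa [yCoord] using hv.2 0 (Nat.zero_le _)
  simp [jetBase, hv.1, h0]

theorem totalDeriv_high {k : ℕ} {g : Jet n → ℂ}
    (hg : ∀ (j v : Jet n), IsHigh k v → g (j + v) = g j) (j v : Jet n) (hv : IsHigh (k + 1) v) :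
    totalDeriv g (j + v) = totalDeriv g j := by
  have h1 : fderiv ℂ g (j + v) = fderiv ℂ g j := by
    rw [← fderiv_comp_add_right]
    congr 1
    exact funext fun i => hg i v (hv.mono (Nat.le_succ k))
  have h2 : totalDir (j + v) = totalDir j + shiftL n v := by
    rw [totalDir_eq, totalDir_eq, map_add, add_assoc]
  unfold totalDeriv
  rw [h1, h2, map_add, fderiv_high (fun c i => hg i _ (hv.shift.smul c)), add_zero]

theorem prolongCoeff_high (X : ℂ × ℂ → ℂ × ℂ) (k : ℕ) (j v : Jet n) (hv : IsHigh k v) :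
    (prolongCoeff X k : Jet n → ℂ) (j + v) = prolongCoeff X k j := by
  induction k generalizing j v with
  | zero => simp only [prolongCoeff, hv.jetBase_add]
  | succ k ih =>
    have hy : yCoord (j + v) (k + 1) = yCoord j (k + 1) := by
      rw [← yCoordL_apply, map_add, yCoordL_apply, yCoordL_apply, hv.2 _ le_rfl, add_zero]
    simp only [prolongCoeff]
    rw [totalDeriv_high ih j v hv, hy,
      totalDeriv_high (k := k) (fun j v hv => by simp only [hv.jetBase_add]) j v hv]

theorem yCoord_prolong (X : ℂ × ℂ → ℂ × ℂ) (j : Jet n) {k : ℕ} (hk : k ≤ n) :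
    yCoord (prolong X j) k = prolongCoeff X k j := by
  simp [yCoord, prolong, Nat.lt_succ_of_le hk]

theorem fderiv_prolong {X : ℂ × ℂ → ℂ × ℂ} {j : Jet n} (hX : AnalyticAt ℂ X (jetBase j))
    (v : Jet n) : fderiv ℂ (prolong X : Jet n → Jet n) j v =
      (fderiv ℂ (fun i : Jet n => (X (jetBase i)).1) j v,
        fun k : Fin (n + 1) => fderiv ℂ (prolongCoeff X k : Jet n → ℂ) j v) := by
  have h1 := (analyticAt_xi hX).differentiableAt.hasFDerivAt
  have h2 : HasFDerivAt (fun i : Jet n => fun k : Fin (n + 1) => prolongCoeff X k i)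
      (ContinuousLinearMap.pi fun k : Fin (n + 1) => fderiv ℂ (prolongCoeff X k : Jet n → ℂ) j) j :=
    hasFDerivAt_pi.2 fun k => (analyticAt_prolongCoeff hX k).differentiableAt.hasFDerivAt
  have h3 : HasFDerivAt (prolong X : Jet n → Jet n) _ j := h1.prodMk h2
  rw [h3.fderiv]
  rfl

/-- `[pr X, D_x] = -(D_x ξ) D_x` on functions of `x, y, …, y⁽ᵏ⁾` with `k < n`. -/
theorem prolong_totalDeriv_comm {X : ℂ × ℂ → ℂ × ℂ} {j : Jet n}
    (hX : AnalyticAt ℂ X (jetBase j)) {k : ℕ} (hk : k < n) {g : Jet n → ℂ}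
    (hg : ∀ (j v : Jet n), IsHigh k v → g (j + v) = g j) (hga : AnalyticAt ℂ g j) :
    fderiv ℂ (totalDeriv g) j (prolong X j) =
      totalDeriv (fun i => fderiv ℂ g i (prolong X i)) j -
        totalDeriv (fun i => (X (jetBase i)).1) j * totalDeriv g j := by
  have h := VectorField.fderiv_apply_lieBracket (𝕜 := ℂ) (n := 2) (f := g) (x := j)
    (V := prolong X) (W := totalDir) hga.contDiffAt (by simp)
    (analyticAt_totalDir j).differentiableAt (analyticAt_prolong hX).differentiableAt
  set c := totalDeriv (fun i : Jet n => (X (jetBase i)).1) j with hc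
  have hv : IsHigh k (VectorField.lieBracket ℂ (prolong X) totalDir j + c • totalDir j) := by
    have hb : VectorField.lieBracket ℂ (prolong X) totalDir j =
        shiftL n (prolong X j) - fderiv ℂ (prolong X : Jet n → Jet n) j (totalDir j) := by
      rw [VectorField.lieBracket, (hasFDerivAt_totalDir j).fderiv]
    rw [hb, fderiv_prolong hX]
    refine ⟨?_, fun i hi => ?_⟩
    · simp [shiftL, totalDir, hc, totalDeriv]
    · have hi' : i < n + 1 := by omega
      simp only [yCoord, hi', dite_true, Prod.snd_add, Prod.snd_sub, Prod.smul_snd, Pi.add_apply,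
        Pi.sub_apply, Pi.smul_apply, smul_eq_mul]
      have e1 : (shiftL n (prolong X j)).2 ⟨i, hi'⟩ = prolongCoeff X (i + 1) j := by
        rw [← yCoord_prolong X j (by omega : i + 1 ≤ n), ← yCoordL_apply]
        rfl
      rw [e1]
      simp only [prolongCoeff, totalDir, ← hc]
      simp only [totalDeriv, totalDir]
      ring
  have h0 := fderiv_high (fun c i => hg i _ (hv.smul c)) j
  rw [map_add, map_smul, h] at h0
  simp only [smul_eq_mul] at h0
  change fderiv ℂ (fun x => fderiv ℂ g x (totalDir x)) j (prolong X j) =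
    fderiv ℂ (fun i => fderiv ℂ g i (prolong X i)) j (totalDir j) - c * fderiv ℂ g j (totalDir j)
  linear_combination h0

theorem fderiv_comp_base {G : ℂ × ℂ → ℂ} {X : ℂ × ℂ → ℂ × ℂ} {j : Jet n}
    (hG : DifferentiableAt ℂ G (jetBase j)) :
    fderiv ℂ (fun i : Jet n => G (jetBase i)) j (prolong X j) =
      fderiv ℂ G (jetBase j) (X (jetBase j)) := by
  have h : HasFDerivAt (fun i : Jet n => G (jetBase i))
      ((fderiv ℂ G (jetBase j)).comp (jetBaseL n)) j :=
    HasFDerivAt.comp (f := fun i : Jet n => jetBase i) j hG.hasFDerivAt (jetBaseL n).hasFDerivAt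
  rw [h.fderiv]
  rfl

theorem lieBracket_fst {X Y : ℂ × ℂ → ℂ × ℂ} {j : Jet n} (hX : AnalyticAt ℂ X (jetBase j))
    (hY : AnalyticAt ℂ Y (jetBase j)) :
    (VectorField.lieBracket ℂ X Y (jetBase j)).1 =
      fderiv ℂ (fun i : Jet n => (Y (jetBase i)).1) j (prolong X j) -
      fderiv ℂ (fun i : Jet n => (X (jetBase i)).1) j (prolong Y j) := by
  rw [fderiv_comp_base (G := fun p => (Y p).1) hY.differentiableAt.fst,
    fderiv_comp_base (G := fun p => (X p).1) hX.differentiableAt.fst,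
    hX.differentiableAt.hasFDerivAt.fst.fderiv, hY.differentiableAt.hasFDerivAt.fst.fderiv]
  rfl

theorem lieBracket_snd {X Y : ℂ × ℂ → ℂ × ℂ} {j : Jet n} (hX : AnalyticAt ℂ X (jetBase j))
    (hY : AnalyticAt ℂ Y (jetBase j)) :
    (VectorField.lieBracket ℂ X Y (jetBase j)).2 =
      fderiv ℂ (fun i : Jet n => (Y (jetBase i)).2) j (prolong X j) -
      fderiv ℂ (fun i : Jet n => (X (jetBase i)).2) j (prolong Y j) := by
  rw [fderiv_comp_base (G := fun p => (Y p).2) hY.differentiableAt.snd,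
    fderiv_comp_base (G := fun p => (X p).2) hX.differentiableAt.snd,
    hX.differentiableAt.hasFDerivAt.snd.fderiv, hY.differentiableAt.hasFDerivAt.snd.fderiv]
  rfl

theorem eventually_jetBase {U : TopologicalSpace.Opens (ℂ × ℂ)} {j : Jet n} (hj : jetBase j ∈ U) :
    ∀ᶠ i in 𝓝 j, jetBase i ∈ U :=
  (jetBaseL n).continuous.continuousAt.eventually (U.isOpen.mem_nhds hj)

theorem totalDeriv_congr_sub {g a b : Jet n → ℂ} {j : Jet n} (h : g =ᶠ[𝓝 j] fun i => a i - b i)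
    (ha : DifferentiableAt ℂ a j) (hb : DifferentiableAt ℂ b j) :
    totalDeriv g j = totalDeriv a j - totalDeriv b j := by
  unfold totalDeriv
  rw [h.fderiv_eq, fderiv_fun_sub ha hb]
  rfl

theorem fderiv_prolongCoeff_succ {X Y : ℂ × ℂ → ℂ × ℂ} {j : Jet n}
    (hX : AnalyticAt ℂ X (jetBase j)) (hY : AnalyticAt ℂ Y (jetBase j)) {k : ℕ} (hk : k < n) :
    fderiv ℂ (prolongCoeff Y (k + 1) : Jet n → ℂ) j (prolong X j) =
      totalDeriv (fun i => fderiv ℂ (prolongCoeff Y k) i (prolong X i)) j -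
        totalDeriv (fun i => (X (jetBase i)).1) j * totalDeriv (prolongCoeff Y k) j -
      (prolongCoeff X (k + 1) j * totalDeriv (fun i => (Y (jetBase i)).1) j +
        yCoord j (k + 1) *
          (totalDeriv (fun i => fderiv ℂ (fun l => (Y (jetBase l)).1) i (prolong X i)) j -
            totalDeriv (fun i => (X (jetBase i)).1) j *
              totalDeriv (fun i => (Y (jetBase i)).1) j)) := by
  have e1 := prolong_totalDeriv_comm hX hk (prolongCoeff_high Y k)
    (analyticAt_prolongCoeff hY k)
  have e2 := prolong_totalDeriv_comm hX hk (g := fun i => (Y (jetBase i)).1)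
    (fun j v hv => by simp only [hv.jetBase_add]) (analyticAt_xi hY)
  have d1 := (analyticAt_totalDeriv (analyticAt_prolongCoeff (n := n) hY k)).differentiableAt
  have d2 := (analyticAt_totalDeriv (analyticAt_xi (n := n) hY)).differentiableAt
  have H : HasFDerivAt (prolongCoeff Y (k + 1) : Jet n → ℂ) _ j :=
    d1.hasFDerivAt.sub ((hasFDerivAt_yCoord (k + 1) j).mul d2.hasFDerivAt)
  rw [H.fderiv, ← e1, ← e2]
  have : yCoordL n (k + 1) (prolong X j) = prolongCoeff X (k + 1) j := by
    rw [yCoordL_apply, yCoord_prolong X j hk]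
  simp only [sub_apply, add_apply, smul_apply, smul_eq_mul, this]
  ring

/-- Prolongation commutes with the Lie bracket. -/
theorem prolongCoeff_lieBracket {U : TopologicalSpace.Opens (ℂ × ℂ)} {X Y : ℂ × ℂ → ℂ × ℂ}
    (hX : AnalyticOnNhd ℂ X U) (hY : AnalyticOnNhd ℂ Y U) (k : ℕ) (hk : k ≤ n) (j : Jet n)
    (hj : jetBase j ∈ U) :
    prolongCoeff (VectorField.lieBracket ℂ X Y) k j =
      fderiv ℂ (prolongCoeff Y k) j (prolong X j) -
        fderiv ℂ (prolongCoeff X k) j (prolong Y j) := by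
  induction k generalizing j with
  | zero => exact lieBracket_snd (hX _ hj) (hY _ hj)
  | succ k ih =>
    have hXj := hX _ hj
    have hYj := hY _ hj
    have a1 : totalDeriv (prolongCoeff (VectorField.lieBracket ℂ X Y) k) j =
        totalDeriv (fun i => fderiv ℂ (prolongCoeff Y k) i (prolong X i)) j -
          totalDeriv (fun i => fderiv ℂ (prolongCoeff X k) i (prolong Y i)) j := by
      refine totalDeriv_congr_sub ?_ ?_ ?_
      · filter_upwards [eventually_jetBase hj] with i hi using ih (by omega) i hi
      · exact (analyticAt_fderiv_apply (analyticAt_prolongCoeff hYj k)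
          (analyticAt_prolong hXj)).differentiableAt
      · exact (analyticAt_fderiv_apply (analyticAt_prolongCoeff hXj k)
          (analyticAt_prolong hYj)).differentiableAt
    have a2 : totalDeriv (fun i : Jet n => (VectorField.lieBracket ℂ X Y (jetBase i)).1) j =
        totalDeriv (fun i => fderiv ℂ (fun l => (Y (jetBase l)).1) i (prolong X i)) j -
          totalDeriv (fun i => fderiv ℂ (fun l => (X (jetBase l)).1) i (prolong Y i)) j := by
      refine totalDeriv_congr_sub ?_ ?_ ?_
      · filter_upwards [eventually_jetBase hj] with i hi using lieBracket_fst (hX _ hi) (hY _ hi)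
      · exact (analyticAt_fderiv_apply (analyticAt_xi hYj) (analyticAt_prolong hXj)).differentiableAt
      · exact (analyticAt_fderiv_apply (analyticAt_xi hXj) (analyticAt_prolong hYj)).differentiableAt
    rw [fderiv_prolongCoeff_succ hXj hYj hk, fderiv_prolongCoeff_succ hYj hXj hk]
    simp only [prolongCoeff]
    rw [a1, a2]
    ring

theorem prolong_lieBracket {U : TopologicalSpace.Opens (ℂ × ℂ)} {X Y : ℂ × ℂ → ℂ × ℂ}
    (hX : AnalyticOnNhd ℂ X U) (hY : AnalyticOnNhd ℂ Y U) (j : Jet n) (hj : jetBase j ∈ U) :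
    prolong (VectorField.lieBracket ℂ X Y) j =
      VectorField.lieBracket ℂ (prolong X : Jet n → Jet n) (prolong Y) j := by
  rw [VectorField.lieBracket, fderiv_prolong (hX _ hj), fderiv_prolong (hY _ hj)]
  refine Prod.ext ?_ (funext fun k => ?_)
  · exact lieBracket_fst (hX _ hj) (hY _ hj)
  · exact prolongCoeff_lieBracket hX hY k (Nat.lt_succ_iff.1 k.2) j hj

theorem prolong_add_smul {U : TopologicalSpace.Opens (ℂ × ℂ)} {X Y : ℂ × ℂ → ℂ × ℂ}
    (hX : AnalyticOnNhd ℂ X U) (hY : AnalyticOnNhd ℂ Y U) (c : ℂ) (j : Jet n)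
    (hj : jetBase j ∈ U) :
    prolong (X + c • Y) j = prolong X j + c • prolong Y j := by
  have key : ∀ (g a b : Jet n → ℂ) (j : Jet n), g =ᶠ[𝓝 j] (fun i => a i + c * b i) →
      DifferentiableAt ℂ a j → DifferentiableAt ℂ b j →
      totalDeriv g j = totalDeriv a j + c * totalDeriv b j := by
    intro g a b j h ha hb
    unfold totalDeriv
    rw [h.fderiv_eq, fderiv_fun_add ha (hb.const_mul c), fderiv_const_mul hb]
    rfl
  have h : ∀ (k : ℕ) (j : Jet n), jetBase j ∈ U →
      prolongCoeff (X + c • Y) k j = prolongCoeff X k j + c * prolongCoeff Y k j := by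
    intro k
    induction k with
    | zero => intro j _; simp [prolongCoeff]
    | succ k ih =>
      intro j hj
      have hXj := hX _ hj
      have hYj := hY _ hj
      have a1 := key (prolongCoeff (X + c • Y) k) (prolongCoeff X k) (prolongCoeff Y k) j
        (by filter_upwards [eventually_jetBase hj] with i hi using ih i hi)
        (analyticAt_prolongCoeff hXj k).differentiableAt
        (analyticAt_prolongCoeff hYj k).differentiableAt
      have a2 := key (fun i => ((X + c • Y) (jetBase i)).1) (fun i => (X (jetBase i)).1)
        (fun i => (Y (jetBase i)).1) j (Filter.Eventually.of_forall fun i => by simp)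
        (analyticAt_xi hXj).differentiableAt (analyticAt_xi hYj).differentiableAt
      simp only [prolongCoeff]
      rw [a1, a2]
      ring
  refine Prod.ext ?_ (funext fun k => ?_)
  · simp [prolong]
  · simpa [prolong] using h k j hj

theorem ScalarODE.analyticAt_lhs (E : ScalarODE n) {j : Jet n} (hj : jetLower j ∈ E.dom) :
    AnalyticAt ℂ E.lhs j := by
  have h1 : AnalyticAt ℂ (fun i : Jet n => i.2 (Fin.last n)) j :=
    ((ContinuousLinearMap.proj (R := ℂ) (φ := fun _ : Fin (n + 1) => ℂ) (Fin.last n)).comp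
      (ContinuousLinearMap.snd ℂ ℂ (Fin (n + 1) → ℂ))).analyticAt j
  exact h1.add (AnalyticAt.comp (f := fun i : Jet n => jetLower i) (E.holo _ hj)
    ((jetLowerL n).analyticAt j))

theorem ScalarODE.fderiv_lhs (E : ScalarODE n) {j : Jet n} (hj : jetLower j ∈ E.dom) (v : Jet n) :
    fderiv ℂ E.lhs j v = v.2 (Fin.last n) + fderiv ℂ E.f (jetLower j) (jetLower v) := by
  have h1 := ((ContinuousLinearMap.proj (R := ℂ) (φ := fun _ : Fin (n + 1) => ℂ)
    (Fin.last n)).comp (ContinuousLinearMap.snd ℂ ℂ (Fin (n + 1) → ℂ))).hasFDerivAt (x := j)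
  have h2 : HasFDerivAt (fun i : Jet n => E.f (jetLower i))
      ((fderiv ℂ E.f (jetLower j)).comp (jetLowerL n)) j :=
    HasFDerivAt.comp (f := fun i : Jet n => jetLower i) j
      (E.holo _ hj).differentiableAt.hasFDerivAt (jetLowerL n).hasFDerivAt
  have h3 : HasFDerivAt E.lhs _ j := h1.add h2
  rw [h3.fderiv]
  rfl

/-- A function vanishing on the equation manifold has zero derivative along tangent vectors. -/
theorem ScalarODE.fderiv_eq_zero_of_tangent (E : ScalarODE n) {U : TopologicalSpace.Opens (ℂ × ℂ)}
    {G : Jet n → ℂ} {j v : Jet n} (hj : jetBase j ∈ U) (hd : jetLower j ∈ E.dom)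
    (he : E.lhs j = 0) (hG : DifferentiableAt ℂ G j)
    (hG0 : ∀ i : Jet n, jetBase i ∈ U → jetLower i ∈ E.dom → E.lhs i = 0 → G i = 0)
    (hv : fderiv ℂ E.lhs j v = 0) : fderiv ℂ G j v = 0 := by
  let e : Jet n := (0, Pi.single (Fin.last n) 1)
  have hlow : ∀ (i : Jet n) (c : ℂ), jetLower (i + c • e) = jetLower i := by
    intro i c
    refine Prod.ext ?_ (funext fun k => ?_)
    · simp [jetLower, e]
    · simp [jetLower, e]
  let P : Jet n → Jet n := fun i => i - E.lhs i • e
  have hPj : P j = j := by simp [P, he]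
  have hlowP : ∀ i, jetLower (P i) = jetLower i := fun i => by
    simpa [P, sub_eq_add_neg] using hlow i (-E.lhs i)
  have hlhsP : ∀ i, E.lhs (P i) = 0 := by
    intro i
    have hl : (P i).2 (Fin.last n) = i.2 (Fin.last n) - E.lhs i := by simp [P, e]
    rw [ScalarODE.lhs, hlowP, hl, ScalarODE.lhs]
    ring
  have hP : HasFDerivAt P (ContinuousLinearMap.id ℂ _ - (fderiv ℂ E.lhs j).smulRight e) j :=
    (hasFDerivAt_id j).sub ((E.analyticAt_lhs hd).differentiableAt.hasFDerivAt.smul_const e)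
  have hGP : HasFDerivAt (fun i => G (P i)) ((fderiv ℂ G j).comp
      (ContinuousLinearMap.id ℂ _ - (fderiv ℂ E.lhs j).smulRight e)) j := by
    refine HasFDerivAt.comp j (g := G) ?_ hP
    rw [hPj]
    exact hG.hasFDerivAt
  have hz : (fun i => G (P i)) =ᶠ[𝓝 j] fun _ => 0 := by
    have hU : ∀ᶠ i in 𝓝 j, jetBase (P i) ∈ U := by
      have := hP.continuousAt.eventually (eventually_jetBase (hPj.symm ▸ hj))
      exact this
    have hD : ∀ᶠ i in 𝓝 j, jetLower i ∈ E.dom :=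
      (jetLowerL n).continuous.continuousAt.eventually (E.dom.isOpen.mem_nhds hd)
    filter_upwards [hU, hD] with i h1 h2
    exact hG0 _ h1 (by rwa [hlowP]) (hlhsP i)
  have h0 := hGP.fderiv
  rw [hz.fderiv_eq, fderiv_const_apply] at h0
  have := congrArg (fun L : Jet n →L[ℂ] ℂ => L v) h0
  simpa [hv] using this.symm

end Prolongation

/-- The point symmetry algebra over `U` of a scalar ODE: the Lie algebra of all holomorphic vector
fields on `U` which satisfy the invariance condition. -/
def pointSymmetryAlgebra {n : ℕ} (E : ScalarODE n) (U : TopologicalSpace.Opens (ℂ × ℂ)) :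
    LieSubalgebra ℂ (HolVectorField U) where
  carrier := {X | IsPointSymmetry E U X.1}
  add_mem' := by
    intro X Y hX hY j hj hd he
    have h := prolong_add_smul X.analytic Y.analytic 1 j hj
    rw [one_smul, one_smul] at h
    rw [HolVectorField.add_val, h, map_add, hX j hj hd he, hY j hj hd he, add_zero]
  zero_mem' := by
    intro j hj hd he
    have h0 := (0 : HolVectorField U).analytic
    have h := prolong_add_smul h0 h0 (-1) j hj
    rw [HolVectorField.zero_val] at h
    simp only [smul_zero, add_zero, neg_smul, one_smul, add_neg_cancel] at h
    rw [HolVectorField.zero_val, h, map_zero]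
  smul_mem' := by
    intro c X hX j hj hd he
    have h0 := (0 : HolVectorField U).analytic
    have h1 := prolong_add_smul h0 h0 (-1) j hj
    have h := prolong_add_smul h0 X.analytic c j hj
    rw [HolVectorField.zero_val] at h h1
    simp only [smul_zero, add_zero, neg_smul, one_smul, add_neg_cancel] at h1
    rw [zero_add, h1, zero_add] at h
    rw [HolVectorField.smul_val, h, map_smul, hX j hj hd he, smul_zero]
  lie_mem' := by
    intro X Y hX hY j hj hd he
    have hXj := X.analytic _ hj
    have hYj := Y.analytic _ hj
    have hE := E.analyticAt_lhs hd
    rw [HolVectorField.bracket_val, prolong_lieBracket X.analytic Y.analytic j hj,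
      VectorField.fderiv_apply_lieBracket (n := 2) hE.contDiffAt (by simp)
        (analyticAt_prolong hYj).differentiableAt (analyticAt_prolong hXj).differentiableAt,
      E.fderiv_eq_zero_of_tangent hj hd he
        (analyticAt_fderiv_apply hE (analyticAt_prolong hYj)).differentiableAt hY (hX j hj hd he),
      E.fderiv_eq_zero_of_tangent hj hd he
        (analyticAt_fderiv_apply hE (analyticAt_prolong hXj)).differentiableAt hX (hY j hj hd he),
      sub_zero]

end

/-! Fix a jet `j` at which `f` is defined and put b = `jetBase j`. It suffices that a symmetry X =
(ξ, η) vanishes if its derivatives of order at most n vanish at b: then finitely many Taylor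
coefficients at b embed the algebra in a finite-dimensional space.

Suppose all derivatives of X of order less than r vanish at b. Consider jets over a neighbourhood of
b on which y' has a constant value p and y⁽ⁿ⁾ is given by the equation. Along them η⁽ⁿ⁾ equals (∂_x
+ p∂_y)ⁿ(η - pξ) up to an error vanishing to order r+1-n, and every term of the symmetry condition
that involves f vanishes to that order as well (`IsJetSection.vanishesToOrder_prolongCoeff_sub`,
`IsPointSymmetry.vanishesToOrder`). So f drops out at leading order: the derivatives of order r-n of
(∂_x + p∂_y)ⁿ(η - pξ) vanish at b, exactly as for y⁽ⁿ⁾ = 0.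

The domain of f is open, so this holds for infinitely many p and is a polynomial identity in p.
Write e_s, x_s for the values at b of ∂_x^(r-s) ∂_y^s applied to η, ξ. Comparing coefficients gives,
for every l ≤ r-n, that e_l = 0 and C(n,i+1) e_(l+i+1) = C(n,i) x_(l+i) for i ≤ n. If r ≥ n+1, at
least two values of l are available and the relations force all e_s and x_s to vanish
(`eq_zero_of_coeff_relations`). Hence vanishing to order n+1 propagates to infinite order, and the
identity theorem on the connected set U gives X = 0.

For n = 2, ξ and η have twelve derivatives of order at most 2. Once those of order less than 2
vanish, the case r = 2, l = 0 gives four relations among the six of order 2; eight parameters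
remain. -/

noncomputable section

/-! ### Calculus of the order of vanishing at a point. -/

section VanishingOrder

variable {E F G H : Type} [NormedAddCommGroup E] [NormedSpace ℂ E]
  [NormedAddCommGroup F] [NormedSpace ℂ F] [NormedAddCommGroup G] [NormedSpace ℂ G]
  [NormedAddCommGroup H] [NormedSpace ℂ H]

/-- All derivatives of order less than `k` of `g` vanish at `x`. -/
def VanishesToOrder (k : ℕ) (g : E → F) (x : E) : Prop :=
  ∀ i < k, iteratedFDeriv ℂ i g x = 0

theorem vanishesToOrder_zero (g : E → F) (x : E) : VanishesToOrder 0 g x :=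
  fun i hi => absurd hi (Nat.not_lt_zero i)

theorem VanishesToOrder.mono {k l : ℕ} {g : E → F} {x : E} (h : VanishesToOrder l g x)
    (hkl : k ≤ l) : VanishesToOrder k g x :=
  fun i hi => h i (hi.trans_le hkl)

theorem VanishesToOrder.congr {k : ℕ} {g g' : E → F} {x : E} (h : VanishesToOrder k g x)
    (hg : g' =ᶠ[𝓝 x] g) : VanishesToOrder k g' x :=
  fun i hi => ((hg.iteratedFDeriv ℂ i).eq_of_nhds).trans (h i hi)

/-- The recursion behind the inductions below: it trades one order for one derivative, at the price
of enlarging the target space. -/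
theorem vanishesToOrder_succ {k : ℕ} {g : E → F} {x : E} :
    VanishesToOrder (k + 1) g x ↔ g x = 0 ∧ VanishesToOrder k (fderiv ℂ g) x := by
  constructor
  · intro h
    refine ⟨?_, fun i hi => ?_⟩
    · have := h 0 (Nat.succ_pos k)
      rwa [← norm_eq_zero, norm_iteratedFDeriv_zero, norm_eq_zero] at this
    · rw [← norm_eq_zero, norm_iteratedFDeriv_fderiv, h (i + 1) (by omega), norm_zero]
  · rintro ⟨h0, h1⟩ i hi
    cases i with
    | zero => rw [← norm_eq_zero, norm_iteratedFDeriv_zero, h0, norm_zero]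
    | succ i => rw [← norm_eq_zero, ← norm_iteratedFDeriv_fderiv, h1 i (by omega), norm_zero]

theorem VanishesToOrder.fderiv {k : ℕ} {g : E → F} {x : E} (h : VanishesToOrder k g x) :
    VanishesToOrder (k - 1) (fderiv ℂ g) x := by
  cases k with
  | zero => exact vanishesToOrder_zero _ _
  | succ k => exact (vanishesToOrder_succ.1 h).2

theorem VanishesToOrder.add [CompleteSpace F] {k : ℕ} {g g' : E → F} {x : E} (h : VanishesToOrder k g x)
    (h' : VanishesToOrder k g' x) (hg : AnalyticAt ℂ g x) (hg' : AnalyticAt ℂ g' x) :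
    VanishesToOrder k (fun y => g y + g' y) x := fun i hi => by
  have := iteratedFDeriv_add_apply (i := i) hg.contDiffAt hg'.contDiffAt
  rw [h i hi, h' i hi, add_zero] at this
  exact this

theorem VanishesToOrder.sum [CompleteSpace F] {ι : Type*} (s : Finset ι) {k : ℕ} {g : ι → E → F} {x : E}
    (h : ∀ a ∈ s, VanishesToOrder k (g a) x) (hg : ∀ a ∈ s, AnalyticAt ℂ (g a) x) :
    VanishesToOrder k (fun y => ∑ a ∈ s, g a y) x := by
  classical
  induction s using Finset.induction_on with
  | empty => exact fun i _ => by simp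
  | insert a s ha ih =>
    have := (h a (by simp)).add (ih (fun b hb => h b (by simp [hb])) fun b hb => hg b (by simp [hb]))
      (hg a (by simp)) (Finset.analyticAt_fun_sum s fun b hb => hg b (by simp [hb]))
    simpa only [Finset.sum_insert ha] using this

theorem VanishesToOrder.clm [CompleteSpace F] {k : ℕ} {g : E → F} {x : E} (L : F →L[ℂ] G)
    (h : VanishesToOrder k g x) (hg : AnalyticAt ℂ g x) :
    VanishesToOrder k (fun y => L (g y)) x := fun i hi => by
  have := L.iteratedFDeriv_comp_left (n := i) hg.contDiffAt le_rfl
  rw [h i hi] at this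
  refine Eq.trans this ?_
  ext m
  simp

theorem VanishesToOrder.neg [CompleteSpace F] {k : ℕ} {g : E → F} {x : E} (h : VanishesToOrder k g x)
    (hg : AnalyticAt ℂ g x) : VanishesToOrder k (fun y => -g y) x :=
  h.clm (-ContinuousLinearMap.id ℂ F) hg

theorem VanishesToOrder.sub [CompleteSpace F] {k : ℕ} {g g' : E → F} {x : E} (h : VanishesToOrder k g x)
    (h' : VanishesToOrder k g' x) (hg : AnalyticAt ℂ g x) (hg' : AnalyticAt ℂ g' x) :
    VanishesToOrder k (fun y => g y - g' y) x := by
  simpa only [sub_eq_add_neg] using h.add (h'.neg hg') hg hg'.fun_neg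

theorem vanishesToOrder_of_forall_apply [CompleteSpace G] {k : ℕ} {g : E → F →L[ℂ] G} {x : E}
    (hg : AnalyticAt ℂ g x) (h : ∀ v, VanishesToOrder k (fun y => g y v) x) :
    VanishesToOrder k g x := fun i hi => by
  ext m v
  have := (ContinuousLinearMap.apply ℂ G v).iteratedFDeriv_comp_left (n := i) hg.contDiffAt le_rfl
  have h0 : iteratedFDeriv ℂ i (⇑(ContinuousLinearMap.apply ℂ G v) ∘ g) x = 0 := h v i hi
  rw [h0] at this
  simpa using (congrArg (fun A => A m) this).symm

/-- By the Leibniz rule the derivative is a sum of two bilinear expressions of the same kind, one in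
g' and one in g. The spaces must vary in the induction because the pairings become `precompR` and
`precompL`. -/
theorem VanishesToOrder.bilinear [CompleteSpace F] [CompleteSpace G] [CompleteSpace H] {k : ℕ}
    {c : E → F} {g : E → G} {x : E}
    (B : F →L[ℂ] G →L[ℂ] H) (hc : AnalyticAt ℂ c x) (hg : AnalyticAt ℂ g x)
    (h : VanishesToOrder k g x) : VanishesToOrder k (fun y => B (c y) (g y)) x := by
  induction k generalizing F G H with
  | zero => exact vanishesToOrder_zero _ _
  | succ k ih =>
    refine vanishesToOrder_succ.2 ⟨by simp [(vanishesToOrder_succ.1 h).1], ?_⟩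
    have h1 := ih (B.precompR E) hc hg.fderiv (vanishesToOrder_succ.1 h).2
    have h2 := ih (B.precompL E) hc.fderiv hg (h.mono k.le_succ)
    refine (h1.add h2 ?_ ?_).congr ?_
    · exact AnalyticAt.comp₂ (h := fun q : F × (E →L[ℂ] G) => B.precompR E q.1 q.2)
        ((B.precompR E).analyticAt_bilinear _) hc hg.fderiv
    · exact AnalyticAt.comp₂ (h := fun q : (E →L[ℂ] F) × G => B.precompL E q.1 q.2)
        ((B.precompL E).analyticAt_bilinear _) hc.fderiv hg
    · filter_upwards [hc.eventually_analyticAt, hg.eventually_analyticAt] with y hy hy'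
      exact B.fderiv_of_bilinear hy.differentiableAt hy'.differentiableAt

theorem VanishesToOrder.mul {k : ℕ} {c g : E → ℂ} {x : E} (hc : AnalyticAt ℂ c x)
    (hg : AnalyticAt ℂ g x) (h : VanishesToOrder k g x) :
    VanishesToOrder k (fun y => c y * g y) x :=
  h.bilinear (ContinuousLinearMap.mul ℂ ℂ) hc hg

theorem VanishesToOrder.clm_apply [CompleteSpace F] [CompleteSpace G] {k : ℕ}
    {g : E → F →L[ℂ] G} {w : E → F} {x : E} (hg : AnalyticAt ℂ g x) (hw : AnalyticAt ℂ w x)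
    (h : VanishesToOrder k g x) : VanishesToOrder k (fun y => g y (w y)) x :=
  h.bilinear (ContinuousLinearMap.apply ℂ G) hw hg

theorem VanishesToOrder.comp [CompleteSpace E] [CompleteSpace F] [CompleteSpace G] {k : ℕ}
    {g : F → G} {s : E → F} {x : E} (hg : AnalyticAt ℂ g (s x)) (hs : AnalyticAt ℂ s x)
    (h : VanishesToOrder k g (s x)) : VanishesToOrder k (fun y => g (s y)) x := by
  induction k generalizing G with
  | zero => exact vanishesToOrder_zero _ _
  | succ k ih =>
    refine vanishesToOrder_succ.2 ⟨(vanishesToOrder_succ.1 h).1, ?_⟩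
    have h1 := ih hg.fderiv (vanishesToOrder_succ.1 h).2
    have h2 := h1.bilinear (ContinuousLinearMap.compL ℂ E F G).flip hs.fderiv (hg.fderiv.fun_comp hs)
    refine h2.congr ?_
    filter_upwards [hs.continuousAt.eventually hg.eventually_analyticAt,
      hs.eventually_analyticAt] with y hy hy'
    exact fderiv_fun_comp y hy.differentiableAt hy'.differentiableAt

theorem fderiv_fderiv_comm [CompleteSpace F] {g : E → F} {x : E} (hg : AnalyticAt ℂ g x)
    (v w : E) : fderiv ℂ (fun y => fderiv ℂ g y v) x w = fderiv ℂ (fun y => fderiv ℂ g y w) x v := by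
  have h : ∀ v w, fderiv ℂ (fun y => fderiv ℂ g y v) x w = fderiv ℂ (fderiv ℂ g) x w v := by
    intro v w
    rw [fderiv_clm_apply hg.fderiv.differentiableAt (differentiableAt_const v)]
    simp
  rw [h, h]
  exact ((hg.contDiffAt (n := 2)).isSymmSndFDerivAt (by simp)).eq w v

/-- Differentiation along a set does not lower the order of vanishing on it. -/
theorem vanishesToOrder_fderiv_apply_of_add_smul_mem [CompleteSpace F] {S : Set E} {v : E}
    (hS : ∀ x ∈ S, ∀ c : ℂ, x + c • v ∈ S) {k : ℕ} {g : E → F} (hg : AnalyticOnNhd ℂ g S)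
    (h : ∀ x ∈ S, VanishesToOrder k g x) {x : E} (hx : x ∈ S) :
    VanishesToOrder k (fun y => fderiv ℂ g y v) x := by
  induction k generalizing F x with
  | zero => exact vanishesToOrder_zero _ _
  | succ k ih =>
    refine vanishesToOrder_succ.2 ⟨?_, ?_⟩
    · rw [← (hg x hx).differentiableAt.lineDeriv_eq_fderiv]
      have : (fun t : ℂ => g (x + t • v)) = fun _ => 0 :=
        funext fun t => (vanishesToOrder_succ.1 (h _ (hS x hx t))).1
      simp [lineDeriv, this]
    -- By symmetry of the second derivative, differentiating the v-derivative of g is the same as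
    -- taking the v-derivative of `fderiv ℂ g`, to which the induction hypothesis applies.
    · refine (ih (fun y hy => (hg y hy).fderiv)
        (fun y hy => (vanishesToOrder_succ.1 (h y hy)).2) hx).congr ?_
      filter_upwards [(hg x hx).eventually_analyticAt] with y hy
      ext w
      rw [fderiv_fderiv_comm hy v w, fderiv_clm_apply hy.fderiv.differentiableAt
        (differentiableAt_const w)]
      simp

theorem eventuallyEq_zero_of_vanishesToOrder [CompleteSpace F] {g : E → F} {x : E}
    (hg : AnalyticAt ℂ g x) (h : ∀ k, VanishesToOrder k g x) : g =ᶠ[𝓝 x] 0 := by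
  obtain ⟨p, r, hp⟩ := hg
  filter_upwards [Metric.eball_mem_nhds x hp.r_pos] with y hy
  have hy' : y - x ∈ Metric.eball 0 r := by
    simpa [edist_eq_enorm_sub] using hy
  have h1 := hp.hasSum_iteratedFDeriv hy'
  have h0 : (fun m : ℕ => ((m.factorial : ℂ))⁻¹ •
      iteratedFDeriv ℂ m g x fun _ => y - x) = fun _ => 0 := by
    funext m
    simp [h (m + 1) m (Nat.lt_succ_self m)]
  rw [h0, add_sub_cancel] at h1
  exact h1.unique hasSum_zero

end VanishingOrder

/-! ### Prolongation along sections of the jet space. -/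

section Fibre

variable {n : ℕ}

/-- The projection of `Jet n` onto the directions in which `x` and `y` do not change. -/
def verticalL (n : ℕ) : Jet n →L[ℂ] Jet n :=
  ContinuousLinearMap.id ℂ _ - ((ContinuousLinearMap.id ℂ ℂ).prodMap
    (ContinuousLinearMap.single ℂ (fun _ : Fin (n + 1) => ℂ) 0)).comp (jetBaseL n)

theorem jetBaseL_verticalL (v : Jet n) : jetBaseL n (verticalL n v) = 0 := by
  ext <;> simp [verticalL, jetBaseL]

theorem verticalL_eq_self {v : Jet n} (hv : jetBaseL n v = 0) : verticalL n v = v := by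
  have h : Prod.map (id : ℂ → ℂ) (Pi.single (M := fun _ : Fin (n + 1) => ℂ) 0) 0 = 0 :=
    Prod.ext rfl (Pi.single_zero _)
  simp [verticalL, hv, h]

/-- Differentiating within the fibre over b costs no order, since g vanishes to order k along the
whole fibre. This is what makes error terms depending on the choice of section harmless. -/
theorem VanishesToOrder.fderiv_vertical {b : ℂ × ℂ} {k : ℕ} {g : Jet n → ℂ}
    (hg : AnalyticOnNhd ℂ g {j | jetBase j = b})
    (h : ∀ j, jetBase j = b → VanishesToOrder k g j) {s w : ℂ × ℂ → Jet n}
    (hs : AnalyticAt ℂ s b) (hw : AnalyticAt ℂ w b) (hsb : jetBase (s b) = b)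
    (hw0 : ∀ᶠ z in 𝓝 b, jetBaseL n (w z) = 0) :
    VanishesToOrder k (fun z => _root_.fderiv ℂ g (s z) (w z)) b := by
  -- The direction `w z` varies with z, so the operator-valued derivative restricted to vertical
  -- vectors is shown to vanish to order k first; it is tested on constant vectors.
  let R := (ContinuousLinearMap.compL ℂ (Jet n) (Jet n) ℂ).flip (verticalL n)
  have hG : AnalyticAt ℂ (fun j => R (_root_.fderiv ℂ g j)) (s b) :=
    (R.analyticAt _).fun_comp (hg _ hsb).fderiv
  have h1 : VanishesToOrder k (fun j => R (_root_.fderiv ℂ g j)) (s b) := by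
    refine vanishesToOrder_of_forall_apply hG fun v => ?_
    refine vanishesToOrder_fderiv_apply_of_add_smul_mem (v := verticalL n v)
      (S := {j | jetBase j = b}) (fun j hj c => ?_) hg h hsb
    change jetBaseL n (j + c • verticalL n v) = b
    rw [map_add, map_smul, jetBaseL_verticalL, smul_zero, add_zero]
    exact hj
  refine ((h1.comp hG hs).clm_apply (hG.fun_comp hs) hw).congr ?_
  filter_upwards [hw0] with z hz
  simp [R, verticalL_eq_self hz]

theorem VanishesToOrder.totalDeriv {k : ℕ} {g : Jet n → ℂ} {j : Jet n} (hg : AnalyticAt ℂ g j)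
    (h : VanishesToOrder k g j) : VanishesToOrder (k - 1) (totalDeriv g) j :=
  h.fderiv.clm_apply hg.fderiv (analyticAt_totalDir j)

theorem analyticAt_yCoord (k : ℕ) (j : Jet n) : AnalyticAt ℂ (fun i : Jet n => yCoord i k) j := by
  simpa only [← yCoordL_apply] using (yCoordL n k).analyticAt j

theorem analyticAt_jetBase (j : Jet n) : AnalyticAt ℂ (jetBase : Jet n → ℂ × ℂ) j :=
  (jetBaseL n).analyticAt j

theorem VanishesToOrder.xi {r : ℕ} {X : ℂ × ℂ → ℂ × ℂ} {j : Jet n}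
    (hX : AnalyticAt ℂ X (jetBase j)) (h : VanishesToOrder r X (jetBase j)) :
    VanishesToOrder r (fun i : Jet n => (X (jetBase i)).1) j :=
  (h.comp hX (analyticAt_jetBase j)).clm (ContinuousLinearMap.fst ℂ ℂ ℂ)
    (hX.fun_comp (analyticAt_jetBase j))

/-- Each total derivative costs at most one order, and η⁽ᵏ⁾ involves derivatives of ξ and η of order
at most k. -/
theorem VanishesToOrder.prolongCoeff {r : ℕ} {X : ℂ × ℂ → ℂ × ℂ} {j : Jet n}
    (hX : AnalyticAt ℂ X (jetBase j)) (h : VanishesToOrder r X (jetBase j)) (k : ℕ) :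
    VanishesToOrder (r - k) (prolongCoeff X k : Jet n → ℂ) j := by
  induction k with
  | zero =>
    exact (h.comp hX (analyticAt_jetBase j)).clm (ContinuousLinearMap.snd ℂ ℂ ℂ)
      (hX.fun_comp (analyticAt_jetBase j))
  | succ k ih =>
    have h1 := analyticAt_prolongCoeff hX k
    have h2 := analyticAt_totalDeriv (analyticAt_xi hX)
    exact (ih.totalDeriv h1).sub (.mul (analyticAt_yCoord (k + 1) j) h2
      (((h.xi hX).totalDeriv (analyticAt_xi hX)).mono (by omega))) (analyticAt_totalDeriv h1)
      ((analyticAt_yCoord (k + 1) j).mul h2)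

/-- The derivative in the direction `v`. -/
def dirDeriv (v : ℂ × ℂ) (u : ℂ × ℂ → ℂ) (z : ℂ × ℂ) : ℂ := fderiv ℂ u z v

theorem analyticAt_dirDeriv {u : ℂ × ℂ → ℂ} {b : ℂ × ℂ} (v : ℂ × ℂ) (hu : AnalyticAt ℂ u b) :
    AnalyticAt ℂ (dirDeriv v u) b :=
  analyticAt_fderiv_apply hu analyticAt_const

theorem analyticAt_dirDeriv_iterate {u : ℂ × ℂ → ℂ} {b : ℂ × ℂ} (v : ℂ × ℂ) (k : ℕ)
    (hu : AnalyticAt ℂ u b) : AnalyticAt ℂ ((dirDeriv v)^[k] u) b := by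
  induction k with
  | zero => exact hu
  | succ k ih =>
    rw [Function.iterate_succ_apply']
    exact analyticAt_dirDeriv v ih

theorem VanishesToOrder.dirDeriv {k : ℕ} {u : ℂ × ℂ → ℂ} {b : ℂ × ℂ} (v : ℂ × ℂ)
    (hu : AnalyticAt ℂ u b) (h : VanishesToOrder k u b) :
    VanishesToOrder (k - 1) (dirDeriv v u) b :=
  h.fderiv.clm_apply hu.fderiv analyticAt_const

/-- A local section of `jetBase` near `b`, along which `y'` takes the constant value `p`. -/
structure IsJetSection (b : ℂ × ℂ) (p : ℂ) (s : ℂ × ℂ → Jet n) : Prop where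
  analyticAt : AnalyticAt ℂ s b
  base : ∀ z, jetBase (s z) = z
  slope : ∀ z, yCoord (s z) 1 = p

namespace IsJetSection

variable {b : ℂ × ℂ} {p : ℂ} {s : ℂ × ℂ → Jet n}

/-- Along a section with constant slope `p`, the total derivative agrees with the derivative in the
direction `(1, p)`, up to terms which vanish to the same order as the function. -/
theorem vanishesToOrder_totalDeriv_sub (hs : IsJetSection b p s) {k : ℕ} {g : Jet n → ℂ}
    (hg : AnalyticOnNhd ℂ g {j | jetBase j = b})
    (h : ∀ j, jetBase j = b → VanishesToOrder k g j) :
    VanishesToOrder k (fun z => totalDeriv g (s z) - dirDeriv (1, p) (fun z => g (s z)) z) b := by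
  -- Both vectors project to (1, p): the first because y' = p on the section, the second because s
  -- is a section. Their difference is therefore vertical.
  have hw : AnalyticAt ℂ (fun z => totalDir (s z) - fderiv ℂ s z (1, p)) b :=
    ((analyticAt_totalDir _).fun_comp hs.analyticAt).fun_sub
      (analyticAt_fderiv_apply hs.analyticAt analyticAt_const)
  refine (VanishesToOrder.fderiv_vertical hg h hs.analyticAt hw (hs.base b) ?_).congr ?_
  · filter_upwards [hs.analyticAt.eventually_analyticAt] with z hz
    have h1 : HasFDerivAt (fun z => jetBaseL n (s z)) ((jetBaseL n).comp (fderiv ℂ s z)) z :=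
      (jetBaseL n).hasFDerivAt.comp z hz.differentiableAt.hasFDerivAt
    have h2 : (fun z => jetBaseL n (s z)) = id := funext hs.base
    rw [h2] at h1
    have h3 := congrArg (fun L => L (1, p)) (h1.unique (hasFDerivAt_id z))
    rw [map_sub, sub_eq_zero]
    refine Eq.trans ?_ h3.symm
    have := hs.slope z
    exact Prod.ext rfl this
  · filter_upwards [hs.analyticAt.eventually_analyticAt, hs.analyticAt.continuousAt.eventually
      (hg _ (hs.base b)).eventually_analyticAt] with z hz hz'
    rw [map_sub, dirDeriv, fderiv_fun_comp z hz'.differentiableAt hz.differentiableAt]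
    rfl

/-- The leading part of a prolongation coefficient along a section. -/
theorem vanishesToOrder_prolongCoeff_sub (hs : IsJetSection b p s) {r : ℕ}
    {X : ℂ × ℂ → ℂ × ℂ} (hX : AnalyticAt ℂ X b) (h : VanishesToOrder r X b) (k : ℕ) :
    VanishesToOrder (r - k) (fun z => prolongCoeff X (k + 1) (s z) -
      (dirDeriv (1, p))^[k + 1] (fun z => (X z).2 - p * (X z).1) z) b := by
  have hS : ∀ j : Jet n, jetBase j = b → AnalyticAt ℂ X (jetBase j) := fun j hj => hj ▸ hX
  have hV : ∀ j : Jet n, jetBase j = b → VanishesToOrder r X (jetBase j) := fun j hj => hj ▸ h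
  have hb : jetBase (s b) = b := hs.base b
  have hXs := hS _ hb
  have hxi : AnalyticOnNhd ℂ (fun j : Jet n => (X (jetBase j)).1) {j | jetBase j = b} :=
    fun j hj => analyticAt_xi (hS j hj)
  have hdxi : AnalyticAt ℂ (fun z => totalDeriv (fun i : Jet n => (X (jetBase i)).1) (s z)) b :=
    (analyticAt_totalDeriv (hxi _ hb)).fun_comp hs.analyticAt
  have hpro : ∀ k, AnalyticAt ℂ (fun z => prolongCoeff X k (s z)) b := fun k =>
    (analyticAt_prolongCoeff hXs k).fun_comp hs.analyticAt
  have hstep : ∀ k, VanishesToOrder (r - k) (fun z => totalDeriv (prolongCoeff X k) (s z) -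
      dirDeriv (1, p) (fun z => prolongCoeff X k (s z)) z) b := fun k =>
    hs.vanishesToOrder_totalDeriv_sub (fun j hj => analyticAt_prolongCoeff (hS j hj) k)
      fun j hj => (hV j hj).prolongCoeff (hS j hj) k
  have hx1 : AnalyticAt ℂ (fun z => (X z).1) b := analyticAt_fst.fun_comp hX
  have hx2 : AnalyticAt ℂ (fun z => (X z).2) b := analyticAt_snd.fun_comp hX
  have hpsi : AnalyticAt ℂ (fun z => (X z).2 - p * (X z).1) b :=
    hx2.fun_sub (analyticAt_const.fun_mul hx1)
  have hstepa : ∀ k, AnalyticAt ℂ (fun z => totalDeriv (prolongCoeff X k) (s z) -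
      dirDeriv (1, p) (fun z => prolongCoeff X k (s z)) z) b := fun k =>
    ((analyticAt_totalDeriv (analyticAt_prolongCoeff hXs k)).fun_comp hs.analyticAt).fun_sub
      (analyticAt_dirDeriv _ (hpro k))
  induction k with
  | zero =>
    -- Here D_x ξ vanishes only to order r-1 while the error must have order r, so the term y' D_x ξ
    -- cannot be discarded. As y' is the constant p, it contributes exactly the -pξ of the leading
    -- part.
    have h1 := hstep 0
    have h2 := hs.vanishesToOrder_totalDeriv_sub hxi fun j hj => (hV j hj).xi (hS j hj)
    have hda := hdxi.fun_sub (analyticAt_dirDeriv (1, p) (hx1.congr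
      (.of_forall fun z => by simp only [hs.base]) :
        AnalyticAt ℂ (fun z => (X (jetBase (s z))).1) b))
    refine (h1.sub (.mul (analyticAt_const (v := p)) hda h2) (hstepa 0)
      (analyticAt_const.fun_mul hda)).congr ?_
    filter_upwards [hx1.eventually_analyticAt, hx2.eventually_analyticAt] with z hz1 hz2
    simp only [prolongCoeff, zero_add, Function.iterate_one, hs.base, hs.slope]
    have : dirDeriv (1, p) (fun z => (X z).2 - p * (X z).1) z =
        dirDeriv (1, p) (fun z => (X z).2) z - p * dirDeriv (1, p) (fun z => (X z).1) z := by
      unfold dirDeriv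
      rw [fderiv_fun_sub hz2.differentiableAt (hz1.differentiableAt.const_mul p),
        fderiv_const_mul hz1.differentiableAt]
      rfl
    rw [this]
    ring
  | succ k ih =>
    have hit := analyticAt_dirDeriv_iterate (1, p) (k + 1) hpsi
    have h1 := hstep (k + 1)
    have h2 := ih.dirDeriv (1, p) ((hpro (k + 1)).fun_sub hit)
    -- From the second step on, the term with D_x ξ vanishes to order r-1, which is at least
    -- r-(k+1), and joins the error.
    have h3 : VanishesToOrder (r - (k + 1)) (fun z => yCoord (s z) (k + 2) *
        totalDeriv (fun i : Jet n => (X (jetBase i)).1) (s z)) b :=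
      .mul ((analyticAt_yCoord (k + 2) _).fun_comp hs.analyticAt) hdxi
        ((VanishesToOrder.comp (analyticAt_totalDeriv (hxi _ hb)) hs.analyticAt
          (((hV _ hb).xi hXs).totalDeriv (hxi _ hb))).mono (by omega))
    have a2 := analyticAt_dirDeriv (1, p) ((hpro (k + 1)).fun_sub hit)
    have a3 := ((analyticAt_yCoord (k + 2) _).fun_comp hs.analyticAt).fun_mul hdxi
    refine ((h1.add (h2.mono (by omega)) (hstepa (k + 1)) a2).sub h3
      ((hstepa (k + 1)).fun_add a2) a3).congr ?_
    filter_upwards [(hpro (k + 1)).eventually_analyticAt, hit.eventually_analyticAt] with z hz1 hz2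
    have : dirDeriv (1, p) (fun z => prolongCoeff X (k + 1) (s z) -
          (dirDeriv (1, p))^[k + 1] (fun z => (X z).2 - p * (X z).1) z) z =
        dirDeriv (1, p) (fun z => prolongCoeff X (k + 1) (s z)) z -
          dirDeriv (1, p) ((dirDeriv (1, p))^[k + 1] (fun z => (X z).2 - p * (X z).1)) z :=
      congrArg (fun L => L (1, p)) (fderiv_fun_sub hz1.differentiableAt hz2.differentiableAt)
    rw [this, Function.iterate_succ_apply' _ (k + 1), prolongCoeff]
    ring

end IsJetSection

/-- The points with `y⁽ⁿ⁾` adjusted such that they lie on the equation manifold. -/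
def ScalarODE.toSolution (E : ScalarODE n) (j : Jet n) : Jet n :=
  j - E.lhs j • (0, Pi.single (Fin.last n) 1)

theorem ScalarODE.jetLower_toSolution (E : ScalarODE n) (j : Jet n) :
    jetLower (E.toSolution j) = jetLower j := by
  refine Prod.ext ?_ (funext fun k => ?_) <;> simp [jetLower, ScalarODE.toSolution]

theorem ScalarODE.lhs_toSolution (E : ScalarODE n) (j : Jet n) : E.lhs (E.toSolution j) = 0 := by
  have : (E.toSolution j).2 (Fin.last n) = j.2 (Fin.last n) - E.lhs j := by
    simp [ScalarODE.toSolution]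
  rw [ScalarODE.lhs, E.jetLower_toSolution, this, ScalarODE.lhs]
  ring

/-- The jet with the same `y', y'', …` and with base point `z`. -/
def Jet.setBase (j : Jet n) (z : ℂ × ℂ) : Jet n := (z.1, Function.update j.2 0 z.2)

theorem analyticAt_setBase (j : Jet n) (b : ℂ × ℂ) : AnalyticAt ℂ j.setBase b := by
  refine analyticAt_fst.prod (AnalyticAt.pi fun k => ?_)
  by_cases hk : k = 0
  · subst hk
    simpa using analyticAt_snd
  · simpa [hk] using analyticAt_const

theorem setBase_self (j : Jet n) : j.setBase (jetBase j) = j := by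
  simp [Jet.setBase, jetBase]

/-- The correction by `E.lhs` changes only y⁽ⁿ⁾. Since n ≥ 2 this is neither y nor y', so base point
and slope survive. -/
theorem isJetSection_toSolution (hn : 2 ≤ n) (E : ScalarODE n) {j : Jet n}
    (hj : jetLower j ∈ E.dom) :
    IsJetSection (jetBase j) (yCoord j 1) fun z => E.toSolution (j.setBase z) where
  analyticAt := by
    have h0 := analyticAt_setBase j (jetBase j)
    have h1 : AnalyticAt ℂ E.lhs (j.setBase (jetBase j)) := by
      rw [setBase_self]
      exact E.analyticAt_lhs hj
    exact h0.sub ((h1.fun_comp h0).smul analyticAt_const)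
  base z := by
    have h0 : (0 : Fin (n + 1)) ≠ Fin.last n := by
      rw [Ne, Fin.ext_iff]
      simp
      omega
    simp [jetBase, ScalarODE.toSolution, Jet.setBase, h0]
  slope z := by
    have h1 : 1 < n + 1 := by omega
    have h2 : (⟨1, h1⟩ : Fin (n + 1)) ≠ Fin.last n := by
      rw [Ne, Fin.ext_iff]
      simp
      omega
    have h3 : (⟨1, h1⟩ : Fin (n + 1)) ≠ 0 := by simp [Fin.ext_iff]
    simp [yCoord, h1, ScalarODE.toSolution, Jet.setBase, h2, h3]

/-- The leading part of the symmetry condition at a base point where `X` vanishes to order `r`. -/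
theorem IsPointSymmetry.vanishesToOrder {E : ScalarODE n} {U : TopologicalSpace.Opens (ℂ × ℂ)}
    {X : ℂ × ℂ → ℂ × ℂ} (hsym : IsPointSymmetry E U X) (hn : 2 ≤ n) {j : Jet n}
    (hjU : jetBase j ∈ U) (hj : jetLower j ∈ E.dom) (hX : AnalyticAt ℂ X (jetBase j)) {r : ℕ}
    (h : VanishesToOrder r X (jetBase j)) :
    VanishesToOrder (r + 1 - n) ((dirDeriv (1, yCoord j 1))^[n]
      fun z => (X z).2 - yCoord j 1 * (X z).1) (jetBase j) := by
  have hs := isJetSection_toSolution hn E hj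
  set s : ℂ × ℂ → Jet n := fun z => E.toSolution (j.setBase z) with hsdef
  set p := yCoord j 1
  set b := jetBase j
  have hlow : ∀ z, jetLower (s z) = jetLower (j.setBase z) := fun z => E.jetLower_toSolution _
  have hlowb : jetLower (s b) ∈ E.dom := by
    rw [hlow, setBase_self]
    exact hj
  have hXs : AnalyticAt ℂ X (jetBase (s b)) := by rw [hs.base]; exact hX
  have hVs : VanishesToOrder r X (jetBase (s b)) := by rw [hs.base]; exact h
  have hla : AnalyticAt ℂ (fun z => jetLower (s z)) b :=
    ((jetLowerL n).analyticAt _).fun_comp hs.analyticAt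
  have hfa : ∀ v, AnalyticAt ℂ (fun z => fderiv ℂ E.f (jetLower (s z)) v) b := fun v =>
    AnalyticAt.fun_comp (g := fun q => fderiv ℂ E.f q v) (f := fun z => jetLower (s z))
      (analyticAt_fderiv_apply (E.holo _ hlowb) analyticAt_const) hla
  have hpa : ∀ k, AnalyticAt ℂ (fun z => prolongCoeff X k (s z)) b := fun k =>
    (analyticAt_prolongCoeff hXs k).fun_comp hs.analyticAt
  have hx1 : AnalyticAt ℂ (fun z => (X z).1) b := analyticAt_fst.fun_comp hX
  have hx2 : AnalyticAt ℂ (fun z => (X z).2) b := analyticAt_snd.fun_comp hX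
  -- The terms containing derivatives of f involve only ξ and η⁽ᵏ⁾ with k ≤ n-1, hence vanish to
  -- order at least r-(n-1).
  have t1 : VanishesToOrder (r + 1 - n)
      (fun z => fderiv ℂ E.f (jetLower (s z)) (1, 0) * (X z).1) b :=
    .mul (hfa _) hx1 ((h.clm (ContinuousLinearMap.fst ℂ ℂ ℂ) hX).mono (by omega))
  have t2 : VanishesToOrder (r + 1 - n) (fun z => ∑ k : Fin n,
      fderiv ℂ E.f (jetLower (s z)) (0, Pi.single k 1) * prolongCoeff X k (s z)) b :=
    VanishesToOrder.sum _ (fun k _ => .mul (hfa _) (hpa k)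
      ((VanishesToOrder.comp (analyticAt_prolongCoeff hXs k) hs.analyticAt
        (hVs.prolongCoeff hXs k)).mono (by omega))) fun k _ => (hfa _).fun_mul (hpa k)
  obtain ⟨m, rfl⟩ : ∃ m, n = m + 1 := ⟨n - 1, by omega⟩
  have t3 := (hs.vanishesToOrder_prolongCoeff_sub hX h m).mono (k := r + 1 - (m + 1)) (by omega)
  have hit := analyticAt_dirDeriv_iterate (1, p) (m + 1)
    (hx2.fun_sub ((analyticAt_const (v := p)).fun_mul hx1))
  have a2 := Finset.analyticAt_fun_sum (N := Finset.univ) fun (k : Fin (m + 1)) _ =>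
    (hfa (0, Pi.single k 1)).fun_mul (hpa k)
  have a1 := (hfa (1, 0)).fun_mul hx1
  have a3 := (hpa (m + 1)).fun_sub hit
  refine (((t3.add t1 a3 a1).add t2 (a3.fun_add a1) a2).neg ((a3.fun_add a1).fun_add a2)).congr ?_
  filter_upwards [U.isOpen.mem_nhds hjU,
    hla.continuousAt.eventually (E.dom.isOpen.mem_nhds hlowb)] with z hzU hzd
  have h0 := hsym (s z) (by rw [hs.base]; exact hzU) hzd (E.lhs_toSolution _)
  rw [E.fderiv_lhs hzd] at h0
  have h1 : jetLower (prolong X (s z)) = (X z).1 • ((1, 0) : ℂ × (Fin (m + 1) → ℂ)) +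
      ∑ k : Fin (m + 1), prolongCoeff X k (s z) • ((0, Pi.single k 1) : ℂ × (Fin (m + 1) → ℂ)) := by
    refine Prod.ext ?_ (funext fun k => ?_)
    · simp [jetLower, prolong, hs.base, Prod.fst_sum]
    · simp [jetLower, prolong, Prod.snd_sum, Finset.sum_apply, Pi.single_apply]
  rw [h1, map_add, map_smul, map_sum] at h0
  simp only [map_smul, smul_eq_mul] at h0
  have h2 : (prolong X (s z)).2 (Fin.last (m + 1)) = prolongCoeff X (m + 1) (s z) := rfl
  rw [h2] at h0
  have h3 : ∑ k : Fin (m + 1), fderiv ℂ E.f (jetLower (s z)) (0, Pi.single k 1) *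
      prolongCoeff X k (s z) = ∑ k : Fin (m + 1), prolongCoeff X k (s z) *
        fderiv ℂ E.f (jetLower (s z)) (0, Pi.single k 1) :=
    Finset.sum_congr rfl fun k _ => mul_comm _ _
  rw [h3]
  linear_combination h0

end Fibre

/-- Holomorphic functions on `U`, extended by zero outside `U`. -/
def holFunctions (U : TopologicalSpace.Opens (ℂ × ℂ)) : Submodule ℂ (ℂ × ℂ → ℂ) where
  carrier := {u | AnalyticOnNhd ℂ u U ∧ ∀ p ∉ U, u p = 0}
  add_mem' := fun {u w} hu hw => ⟨hu.1.add hw.1, fun p hp => by simp [hu.2 p hp, hw.2 p hp]⟩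
  zero_mem' := ⟨analyticOnNhd_const, fun _ _ => rfl⟩
  smul_mem' := fun c u hu =>
    ⟨(analyticOnNhd_const (v := c)).smul hu.1, fun p hp => by simp [hu.2 p hp]⟩

/-! ### Commuting partial derivatives and Taylor coefficients. -/

section PartialDerivatives

variable {U : TopologicalSpace.Opens (ℂ × ℂ)}

theorem holFunctions_ext {u w : holFunctions U} (h : ∀ z ∈ U, u.1 z = w.1 z) : u = w := by
  refine Subtype.ext (funext fun z => ?_)
  by_cases hz : z ∈ U
  · exact h z hz
  · rw [u.2.2 z hz, w.2.2 z hz]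

theorem holFunctions_diffAt (u : holFunctions U) {z : ℂ × ℂ} (hz : z ∈ U) :
    DifferentiableAt ℂ u.1 z :=
  (u.2.1 z hz).differentiableAt

theorem holIndicator_eventuallyEq (u : ℂ × ℂ → ℂ) {z : ℂ × ℂ} (hz : z ∈ U) :
    (U : Set (ℂ × ℂ)).indicator u =ᶠ[𝓝 z] u := by
  filter_upwards [U.isOpen.mem_nhds hz] with w hw using Set.indicator_of_mem hw _

/-- The derivative in the direction `v`, as an operator on holomorphic functions on `U`. -/
def partialDeriv (U : TopologicalSpace.Opens (ℂ × ℂ)) (v : ℂ × ℂ) :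
    Module.End ℂ (holFunctions U) where
  toFun u := ⟨(U : Set (ℂ × ℂ)).indicator (dirDeriv v u.1),
    fun z hz => (analyticAt_dirDeriv v (u.2.1 z hz)).congr (holIndicator_eventuallyEq _ hz).symm,
    fun _ hz => Set.indicator_of_notMem hz _⟩
  map_add' u w := holFunctions_ext fun z hz => by
    have hz' : z ∈ (U : Set (ℂ × ℂ)) := hz
    simp [hz', dirDeriv, fderiv_add (holFunctions_diffAt u hz) (holFunctions_diffAt w hz)]
  map_smul' c u := holFunctions_ext fun z hz => by
    have hz' : z ∈ (U : Set (ℂ × ℂ)) := hz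
    simp [hz', dirDeriv, fderiv_const_smul (holFunctions_diffAt u hz)]

theorem partialDeriv_apply (v : ℂ × ℂ) (u : holFunctions U) {z : ℂ × ℂ} (hz : z ∈ U) :
    (partialDeriv U v u).1 z = dirDeriv v u.1 z :=
  Set.indicator_of_mem (s := (U : Set (ℂ × ℂ))) hz (dirDeriv v u.1)

theorem partialDeriv_eventuallyEq (v : ℂ × ℂ) (u : holFunctions U) {z : ℂ × ℂ} (hz : z ∈ U) :
    (partialDeriv U v u).1 =ᶠ[𝓝 z] dirDeriv v u.1 :=
  holIndicator_eventuallyEq _ hz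

theorem partialDeriv_pow_eventuallyEq (v : ℂ × ℂ) (u : holFunctions U) (k : ℕ) {z : ℂ × ℂ}
    (hz : z ∈ U) : ((partialDeriv U v ^ k) u).1 =ᶠ[𝓝 z] (dirDeriv v)^[k] u.1 := by
  induction k with
  | zero => exact Filter.EventuallyEq.rfl
  | succ k ih =>
    rw [pow_succ', Function.iterate_succ_apply']
    refine (partialDeriv_eventuallyEq v _ hz).trans ?_
    filter_upwards [ih.fderiv (𝕜 := ℂ)] with w hw
    rw [dirDeriv, hw, dirDeriv]

theorem partialDeriv_comm (v w : ℂ × ℂ) : Commute (partialDeriv U v) (partialDeriv U w) := by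
  refine LinearMap.ext fun u => holFunctions_ext fun z hz => ?_
  change (partialDeriv U v (partialDeriv U w u)).1 z = (partialDeriv U w (partialDeriv U v u)).1 z
  rw [partialDeriv_apply _ _ hz, partialDeriv_apply _ _ hz, dirDeriv, dirDeriv,
    (partialDeriv_eventuallyEq w u hz).fderiv_eq, (partialDeriv_eventuallyEq v u hz).fderiv_eq]
  exact fderiv_fderiv_comm (u.2.1 z hz) w v

theorem partialDeriv_eq (v : ℂ × ℂ) :
    partialDeriv U v = v.1 • partialDeriv U (1, 0) + v.2 • partialDeriv U (0, 1) := by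
  refine LinearMap.ext fun u => holFunctions_ext fun z hz => ?_
  have h : v = v.1 • ((1, 0) : ℂ × ℂ) + v.2 • ((0, 1) : ℂ × ℂ) := by ext <;> simp
  change _ = v.1 * (partialDeriv U (1, 0) u).1 z + v.2 * (partialDeriv U (0, 1) u).1 z
  simp only [partialDeriv_apply _ _ hz, dirDeriv]
  conv_lhs => rw [h, map_add, map_smul, map_smul]
  rfl

/-- The value of `∂_x^a ∂_y^c u` at `b`. -/
def partialAt (U : TopologicalSpace.Opens (ℂ × ℂ)) (b : ℂ × ℂ) (a c : ℕ) :
    holFunctions U →ₗ[ℂ] ℂ :=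
  ((LinearMap.proj b).comp (holFunctions U).subtype).comp
    (partialDeriv U (1, 0) ^ a * partialDeriv U (0, 1) ^ c)

theorem partialAt_apply (b : ℂ × ℂ) (a c : ℕ) (u : holFunctions U) :
    partialAt U b a c u = ((partialDeriv U (1, 0) ^ a * partialDeriv U (0, 1) ^ c) u).1 b :=
  rfl

theorem partialAt_succ_left (b : ℂ × ℂ) (a c : ℕ) (u : holFunctions U) :
    partialAt U b (a + 1) c u = partialAt U b a c (partialDeriv U (1, 0) u) := by
  have h : partialDeriv U (1, 0) ^ (a + 1) * partialDeriv U (0, 1) ^ c =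
      (partialDeriv U (1, 0) ^ a * partialDeriv U (0, 1) ^ c) * partialDeriv U (1, 0) := by
    rw [pow_succ, mul_assoc, mul_assoc, ((partialDeriv_comm (U := U) (1, 0) (0, 1)).pow_right c).eq]
  rw [partialAt_apply, h, partialAt_apply]
  rfl

theorem partialAt_succ_right (b : ℂ × ℂ) (a c : ℕ) (u : holFunctions U) :
    partialAt U b a (c + 1) u = partialAt U b a c (partialDeriv U (0, 1) u) := by
  rw [partialAt_apply, partialAt_apply, pow_succ, ← mul_assoc]
  rfl

/-- Passes from Fréchet derivatives to scalar Taylor coefficients, on which the linear algebra of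
the symbol operates. -/
theorem vanishesToOrder_iff_partialAt {b : ℂ × ℂ} (hb : b ∈ U) (k : ℕ) (u : holFunctions U) :
    VanishesToOrder k u.1 b ↔ ∀ a c, a + c < k → partialAt U b a c u = 0 := by
  induction k generalizing u with
  | zero => exact ⟨fun _ a c h => absurd h (Nat.not_lt_zero _), fun _ => vanishesToOrder_zero _ _⟩
  | succ k ih =>
    have hu := u.2.1 b hb
    constructor
    · intro h a c hac
      have hv : ∀ v, VanishesToOrder k (partialDeriv U v u).1 b := fun v =>
        (h.dirDeriv v hu).congr (partialDeriv_eventuallyEq v u hb)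
      cases a with
      | succ a =>
        rw [partialAt_succ_left]
        exact (ih _).1 (hv _) a c (by omega)
      | zero =>
        cases c with
        | succ c =>
          rw [partialAt_succ_right]
          exact (ih _).1 (hv _) 0 c (by omega)
        | zero => exact (vanishesToOrder_succ.1 h).1
    · intro h
      refine vanishesToOrder_succ.2 ⟨h 0 0 (by omega), ?_⟩
      have h1 := (ih (partialDeriv U (1, 0) u)).2 fun a c hac => by
        rw [← partialAt_succ_left]
        exact h _ _ (by omega)
      have h2 := (ih (partialDeriv U (0, 1) u)).2 fun a c hac => by
        rw [← partialAt_succ_right]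
        exact h _ _ (by omega)
      refine vanishesToOrder_of_forall_apply hu.fderiv fun v => ?_
      have a1 := (partialDeriv U (1, 0) u).2.1 b hb
      have a2 := (partialDeriv U (0, 1) u).2.1 b hb
      refine ((VanishesToOrder.mul (analyticAt_const (v := v.1)) a1 h1).add
        (VanishesToOrder.mul (analyticAt_const (v := v.2)) a2 h2) (analyticAt_const.fun_mul a1)
        (analyticAt_const.fun_mul a2)).congr ?_
      filter_upwards [U.isOpen.mem_nhds hb] with z hz
      change dirDeriv v u.1 z = _
      rw [← partialDeriv_apply v u hz, partialDeriv_eq v]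
      rfl

/-- Binomial expansion of `(∂_x + p ∂_y)ⁿ`. -/
theorem partialAt_pow_apply (b : ℂ × ℂ) (a c n : ℕ) (p : ℂ) (u : holFunctions U) :
    partialAt U b a c ((partialDeriv U (1, p) ^ n) u) = ∑ i ∈ Finset.range (n + 1),
      (n.choose i : ℂ) * p ^ i * partialAt U b (a + (n - i)) (c + i) u := by
  have h1 : partialDeriv U (1, p) = p • partialDeriv U (0, 1) + partialDeriv U (1, 0) := by
    rw [partialDeriv_eq (1, p), one_smul, add_comm]
  have hc : Commute (p • partialDeriv U (0, 1)) (partialDeriv U (1, 0)) :=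
    (partialDeriv_comm _ _).smul_left p
  rw [h1, hc.add_pow, LinearMap.sum_apply, map_sum]
  refine Finset.sum_congr rfl fun i _ => ?_
  have h2 : ((p • partialDeriv U (0, 1)) ^ i * partialDeriv U (1, 0) ^ (n - i) *
      (n.choose i : Module.End ℂ (holFunctions U))) u = ((n.choose i : ℂ) * p ^ i) •
        (partialDeriv U (1, 0) ^ (n - i) * partialDeriv U (0, 1) ^ i) u := by
    rw [smul_pow, smul_mul_assoc,
      ((partialDeriv_comm (U := U) (0, 1) (1, 0)).pow_pow i (n - i)).eq,
      ← nsmul_eq_mul', mul_comm (n.choose i : ℂ), mul_smul]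
    simp only [LinearMap.smul_apply, ← Nat.cast_smul_eq_nsmul ℂ]
    rw [smul_comm]
  rw [h2, map_smul, smul_eq_mul, partialAt_apply, partialAt_apply, ← Module.End.mul_apply]
  have h3 : partialDeriv U (1, 0) ^ a * partialDeriv U (0, 1) ^ c *
      (partialDeriv U (1, 0) ^ (n - i) * partialDeriv U (0, 1) ^ i) =
      partialDeriv U (1, 0) ^ (a + (n - i)) * partialDeriv U (0, 1) ^ (c + i) := by
    rw [pow_add, pow_add, mul_assoc, ← mul_assoc (partialDeriv U (0, 1) ^ c),
      ((partialDeriv_comm (U := U) (0, 1) (1, 0)).pow_pow c (n - i)).eq]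
    simp only [mul_assoc]
  rw [h3]

end PartialDerivatives

/-! ### Linear algebra of the leading-order relations. -/

section Symbol

open Polynomial in
-- A polynomial in p with infinitely many roots is zero; the conclusions are its coefficients at p⁰
-- and pⁱ⁺¹.
theorem coeff_relations_of_infinite {n : ℕ} {e x : ℕ → ℂ} {P : Set ℂ} (hP : P.Infinite)
    (h : ∀ p ∈ P, ∑ i ∈ Finset.range (n + 1), (n.choose i : ℂ) * p ^ i * (e i - p * x i) = 0) :
    e 0 = 0 ∧ ∀ i ≤ n, (n.choose (i + 1) : ℂ) * e (i + 1) = n.choose i * x i := by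
  let Q : ℂ[X] := ∑ i ∈ Finset.range (n + 1),
    (monomial i (n.choose i * e i) - monomial (i + 1) (n.choose i * x i))
  have hQ : Q = 0 := by
    refine eq_zero_of_infinite_isRoot Q (hP.mono fun p hp => ?_)
    rw [Set.mem_ofPred_eq, IsRoot, ← h p hp, eval_finsetSum]
    refine Finset.sum_congr rfl fun i _ => ?_
    rw [eval_sub, eval_monomial, eval_monomial]
    ring
  have hcoeff : ∀ s, Q.coeff s = (∑ i ∈ Finset.range (n + 1), if i = s then n.choose i * e i else 0) -
      ∑ i ∈ Finset.range (n + 1), if i + 1 = s then n.choose i * x i else 0 := by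
    intro s
    simp only [Q, finsetSum_coeff, coeff_sub, coeff_monomial, Finset.sum_sub_distrib]
  constructor
  · have := hcoeff 0
    simpa [hQ] using this.symm
  · intro i hi
    have := hcoeff (i + 1)
    simp only [hQ, coeff_zero, add_left_inj, Finset.sum_ite_eq', Finset.mem_range] at this
    rw [if_pos (by omega : i < n + 1)] at this
    -- The sum contains e (i+1) only for i < n. For i = n the binomial coefficient C(n, n+1) = 0
    -- makes up for it, and the relation says x n = 0.
    split_ifs at this with h1
    · linear_combination -this
    · rw [Nat.choose_eq_zero_of_lt (by omega : n < i + 1)]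
      linear_combination -this

/-- Since r ≥ n+1, two consecutive shifts l link the same pair e_(s+1), x_s with different ratios of
binomial coefficients, and the resulting 2×2 system is nonsingular. -/
theorem eq_zero_of_coeff_relations {n r : ℕ} (hr : n + 1 ≤ r) {e x : ℕ → ℂ}
    (h0 : ∀ l ≤ r - n, e l = 0)
    (h : ∀ l ≤ r - n, ∀ i ≤ n,
      (n.choose (i + 1) : ℂ) * e (l + (i + 1)) = n.choose i * x (l + i)) {s : ℕ} (hs : s ≤ r) :
    e s = 0 ∧ x s = 0 := by
  have key : ∀ s, s ≤ r → x s = 0 ∧ (s + 1 ≤ r → e (s + 1) = 0) := by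
    intro s hs
    -- In this range e_(s+1) is already known to vanish, and the relation with l = s, i = 0 reads n
    -- e_(s+1) = x_s.
    by_cases h1 : s + 1 ≤ r - n
    · have h2 := h0 (s + 1) h1
      have h3 := h s (by omega) 0 (Nat.zero_le n)
      simp [h2] at h3
      exact ⟨h3.symm, fun _ => h2⟩
    · obtain ⟨i, rfl⟩ : ∃ i, s = r - n + i := ⟨s - (r - n), by omega⟩
      have h2 := h (r - n) le_rfl i (by omega)
      have hc : (n.choose i : ℂ) ≠ 0 := by
        exact_mod_cast (Nat.choose_pos (by omega : i ≤ n)).ne'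
      rcases eq_or_lt_of_le (by omega : i ≤ n) with rfl | hi
      · rw [Nat.choose_succ_self, Nat.cast_zero, zero_mul] at h2
        exact ⟨(mul_eq_zero.1 h2.symm).resolve_left hc, fun h => by omega⟩
      -- The second shift l = r-n-1 exists because r ≥ n+1. The two relations become (n-i)E = (i+1)Y
      -- and (n-i-1)E = (i+2)Y; subtracting gives E = -Y, and then (n+1)Y = 0.
      · have h3 := h (r - n - 1) (by omega) (i + 1) hi
        rw [show r - n - 1 + (i + 1 + 1) = r - n + (i + 1) by omega,
          show r - n - 1 + (i + 1) = r - n + i by omega] at h3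
        have hc' : (n.choose (i + 1) : ℂ) ≠ 0 := by
          exact_mod_cast (Nat.choose_pos (by omega : i + 1 ≤ n)).ne'
        have c1 : (n.choose (i + 1) : ℂ) * (i + 1) = n.choose i * (n - i) := by
          have := congrArg (Nat.cast (R := ℂ)) (Nat.choose_succ_right_eq n i)
          push_cast [Nat.cast_sub hi.le] at this
          exact this
        have c2 : (n.choose (i + 2) : ℂ) * (i + 2) = n.choose (i + 1) * (n - i - 1) := by
          have := congrArg (Nat.cast (R := ℂ)) (Nat.choose_succ_right_eq n (i + 1))
          push_cast [Nat.cast_sub hi] at this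
          linear_combination this
        set E := e (r - n + (i + 1))
        set Y := x (r - n + i)
        have d1 : ((n : ℂ) - i) * E = (i + 1) * Y := by
          refine mul_left_cancel₀ hc ?_
          linear_combination (i + 1 : ℂ) * h2 - E * c1
        have d2 : ((n : ℂ) - i - 1) * E = (i + 2) * Y := by
          refine mul_left_cancel₀ hc' ?_
          linear_combination (i + 2 : ℂ) * h3 - E * c2
        have d3 : E = -Y := by linear_combination d1 - d2
        have d4 : ((n : ℂ) + 1) * Y = 0 := by
          rw [d3] at d1
          linear_combination -d1
        have hY : Y = 0 := (mul_eq_zero.1 d4).resolve_left (by exact_mod_cast n.succ_ne_zero)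
        exact ⟨hY, fun _ => by rw [add_assoc, show e (r - n + (i + 1)) = E from rfl, d3, hY, neg_zero]⟩
  refine ⟨?_, (key s hs).1⟩
  cases s with
  | zero => exact h0 0 (Nat.zero_le _)
  | succ s => exact (key s (by omega)).2 hs

end Symbol

/-! ### Determination by finitely many Taylor coefficients, and dimension bounds. -/

section Finiteness

variable {U : TopologicalSpace.Opens (ℂ × ℂ)}

/-- The coefficient `ξ` of a vector field. -/
def xiL (U : TopologicalSpace.Opens (ℂ × ℂ)) : HolVectorField U →ₗ[ℂ] holFunctions U where
  toFun X := ⟨fun z => (X.1 z).1, fun z hz => analyticAt_fst.fun_comp (X.analytic z hz),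
    fun z hz => congrArg Prod.fst (X.2.2 z hz)⟩
  map_add' _ _ := rfl
  map_smul' _ _ := rfl

/-- The coefficient `η` of a vector field. -/
def etaL (U : TopologicalSpace.Opens (ℂ × ℂ)) : HolVectorField U →ₗ[ℂ] holFunctions U where
  toFun X := ⟨fun z => (X.1 z).2, fun z hz => analyticAt_snd.fun_comp (X.analytic z hz),
    fun z hz => congrArg Prod.snd (X.2.2 z hz)⟩
  map_add' _ _ := rfl
  map_smul' _ _ := rfl

theorem vanishesToOrder_iff_partialAt_xi_eta {b : ℂ × ℂ} (hb : b ∈ U) (k : ℕ)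
    (X : HolVectorField U) : VanishesToOrder k X.1 b ↔ ∀ a c, a + c < k →
      partialAt U b a c (xiL U X) = 0 ∧ partialAt U b a c (etaL U X) = 0 := by
  have hX := X.analytic b hb
  constructor
  · intro h a c hac
    exact ⟨(vanishesToOrder_iff_partialAt hb k (xiL U X)).1
      (h.clm (ContinuousLinearMap.fst ℂ ℂ ℂ) hX) a c hac,
      (vanishesToOrder_iff_partialAt hb k (etaL U X)).1
      (h.clm (ContinuousLinearMap.snd ℂ ℂ ℂ) hX) a c hac⟩
  · intro h
    have h1 := (vanishesToOrder_iff_partialAt hb k (xiL U X)).2 fun a c hac => (h a c hac).1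
    have h2 := (vanishesToOrder_iff_partialAt hb k (etaL U X)).2 fun a c hac => (h a c hac).2
    have a1 := (xiL U X).2.1 b hb
    have a2 := (etaL U X).2.1 b hb
    refine ((h1.clm (ContinuousLinearMap.inl ℂ ℂ ℂ) a1).add
      (h2.clm (ContinuousLinearMap.inr ℂ ℂ ℂ) a2)
      (((ContinuousLinearMap.inl ℂ ℂ ℂ).analyticAt _).fun_comp a1)
      (((ContinuousLinearMap.inr ℂ ℂ ℂ).analyticAt _).fun_comp a2)).congr
      (.of_forall fun z => ?_)
    change X.1 z = ((X.1 z).1, 0) + (0, (X.1 z).2)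
    simp

/-- Only y' is varied, with the other coordinates of `j` kept; openness of the domain leaves a
neighbourhood of admissible values. -/
theorem infinite_slopes {n : ℕ} (hn : 2 ≤ n) (E : ScalarODE n) {j : Jet n}
    (hj : jetLower j ∈ E.dom) :
    {p : ℂ | ∃ i : Jet n, jetBase i = jetBase j ∧ jetLower i ∈ E.dom ∧ yCoord i 1 = p}.Infinite := by
  have h1 : 1 < n + 1 := by omega
  let t : ℂ → Jet n := fun p => (j.1, Function.update j.2 ⟨1, h1⟩ p)
  have ht : Continuous t := by fun_prop
  have ht0 : t (j.2 ⟨1, h1⟩) = j := by simp [t]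
  refine (infinite_of_mem_nhds (j.2 ⟨1, h1⟩) (((jetLowerL n).continuous.comp ht).continuousAt
    (E.dom.isOpen.mem_nhds ?_))).mono fun p hp => ⟨t p, ?_, hp, ?_⟩
  · rw [Function.comp_apply, ht0]
    exact hj
  · have : (0 : Fin (n + 1)) ≠ ⟨1, h1⟩ := by simp [Fin.ext_iff]
    simp [t, jetBase, this]
  · simp [t, yCoord, h1]

/-- The relations between the lowest-order derivatives of a point symmetry. -/
theorem IsPointSymmetry.partialAt_relations {n : ℕ} {E : ScalarODE n} {X : HolVectorField U}
    (hsym : IsPointSymmetry E U X.1) (hn : 2 ≤ n) {j : Jet n}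
    (hjU : jetBase j ∈ U) (hj : jetLower j ∈ E.dom) {r l : ℕ} (hl : l + n ≤ r)
    (h : VanishesToOrder r X.1 (jetBase j)) :
    partialAt U (jetBase j) (r - l) l (etaL U X) = 0 ∧ ∀ i ≤ n,
      (n.choose (i + 1) : ℂ) *
        partialAt U (jetBase j) (r - (l + (i + 1))) (l + (i + 1)) (etaL U X) =
      n.choose i * partialAt U (jetBase j) (r - (l + i)) (l + i) (xiL U X) := by
  refine coeff_relations_of_infinite
    (e := fun i => partialAt U (jetBase j) (r - (l + i)) (l + i) (etaL U X))
    (x := fun i => partialAt U (jetBase j) (r - (l + i)) (l + i) (xiL U X))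
    (infinite_slopes hn E hj) ?_
  rintro p ⟨i, hib, hid, rfl⟩
  rw [← hib] at hjU h ⊢
  set p := yCoord i 1
  have h1 := hsym.vanishesToOrder hn hjU hid (X.analytic _ hjU) h
  have h2 := h1.congr (partialDeriv_pow_eventuallyEq (1, p) (etaL U X - p • xiL U X) n hjU)
  -- The derivative ∂_x^(r-n-l) ∂_y^l has order r-n, the highest one covered by vanishing to order
  -- r+1-n.
  have h3 := (vanishesToOrder_iff_partialAt hjU _ _).1 h2 (r - n - l) l (by omega)
  rw [partialAt_pow_apply] at h3
  rw [← h3]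
  refine Finset.sum_congr rfl fun m hm => ?_
  rw [Finset.mem_range] at hm
  rw [show r - n - l + (n - m) = r - (l + m) by omega, map_sub, map_smul, smul_eq_mul]

/-- With r = n+1+k the symbol relations kill all derivatives of order r, so the order of vanishing
rises by one at each step. -/
theorem IsPointSymmetry.vanishesToOrder_of_partialAt {n : ℕ} {E : ScalarODE n}
    {X : HolVectorField U} (hsym : IsPointSymmetry E U X.1) (hn : 2 ≤ n) {j : Jet n}
    (hjU : jetBase j ∈ U) (hj : jetLower j ∈ E.dom)
    (h : VanishesToOrder (n + 1) X.1 (jetBase j)) (k : ℕ) :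
    VanishesToOrder (n + 1 + k) X.1 (jetBase j) := by
  induction k with
  | zero => exact h
  | succ k ih =>
    refine (vanishesToOrder_iff_partialAt_xi_eta hjU _ X).2 fun a c hac => ?_
    rcases Nat.lt_or_ge (a + c) (n + 1 + k) with h1 | h1
    · exact (vanishesToOrder_iff_partialAt_xi_eta hjU _ X).1 ih a c h1
    · have h2 := eq_zero_of_coeff_relations (n := n) (r := n + 1 + k) (by omega)
        (e := fun s => partialAt U (jetBase j) (n + 1 + k - s) s (etaL U X))
        (x := fun s => partialAt U (jetBase j) (n + 1 + k - s) s (xiL U X))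
        (fun l hl => (hsym.partialAt_relations hn hjU hj (by omega) ih).1)
        (fun l hl => (hsym.partialAt_relations hn hjU hj (by omega) ih).2) (s := c) (by omega)
      obtain rfl : a = n + 1 + k - c := by omega
      exact ⟨h2.2, h2.1⟩

/-- A point symmetry is determined by its Taylor coefficients of order at most `n`. -/
theorem IsPointSymmetry.eq_zero {n : ℕ} {E : ScalarODE n} {X : HolVectorField U}
    (hsym : IsPointSymmetry E U X.1) (hn : 2 ≤ n) (hU : IsPreconnected (U : Set (ℂ × ℂ)))
    {j : Jet n} (hjU : jetBase j ∈ U) (hj : jetLower j ∈ E.dom)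
    (h : VanishesToOrder (n + 1) X.1 (jetBase j)) : X = 0 := by
  refine HolVectorField.ext' fun z hz => ?_
  exact X.analytic.eqOn_zero_of_preconnected_of_eventuallyEq_zero hU hjU
    (eventuallyEq_zero_of_vanishesToOrder (X.analytic _ hjU) fun k =>
      (hsym.vanishesToOrder_of_partialAt hn hjU hj h k).mono (by omega)) hz

theorem finiteDimensional_pointSymmetryAlgebra {n : ℕ} (hn : 2 ≤ n) (E : ScalarODE n)
    (hU : IsPreconnected (U : Set (ℂ × ℂ))) {j : Jet n} (hjU : jetBase j ∈ U)
    (hj : jetLower j ∈ E.dom) : FiniteDimensional ℂ (pointSymmetryAlgebra E U) := by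
  -- A generous index set: injectivity needs only the pairs with a + c ≤ n, all of which it
  -- contains.
  let ι := Fin (n + 1) × Fin (n + 1)
  let Φ : pointSymmetryAlgebra E U →ₗ[ℂ] (ι → ℂ × ℂ) :=
    (LinearMap.pi fun q : ι => ((partialAt U (jetBase j) q.1 q.2).comp (xiL U)).prod
      ((partialAt U (jetBase j) q.1 q.2).comp (etaL U))).comp
      (pointSymmetryAlgebra E U).toSubmodule.subtype
  refine Module.Finite.of_injective Φ ((injective_iff_map_eq_zero Φ).2 fun X hX => ?_)
  refine Subtype.ext (IsPointSymmetry.eq_zero X.2 hn hU hjU hj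
    ((vanishesToOrder_iff_partialAt_xi_eta hjU _ _).2 fun a c hac => ?_))
  have := congrFun hX (⟨a, by omega⟩, ⟨c, by omega⟩)
  exact Prod.mk_inj.1 this

theorem finrank_pointSymmetryAlgebra_two_le (E : ScalarODE 2)
    (hU : IsPreconnected (U : Set (ℂ × ℂ))) {j : Jet 2} (hjU : jetBase j ∈ U)
    (hj : jetLower j ∈ E.dom) : Module.finrank ℂ (pointSymmetryAlgebra E U) ≤ 8 := by
  let D := partialAt U (jetBase j)
  let Φ : pointSymmetryAlgebra E U →ₗ[ℂ] (Fin 8 → ℂ) :=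
    -- The values and first derivatives of ξ and η give six parameters; the other two are ξ_xx and
    -- ξ_xy, which the relations leave free.
    (LinearMap.pi ![(D 0 0).comp (xiL U), (D 1 0).comp (xiL U), (D 0 1).comp (xiL U),
      (D 2 0).comp (xiL U), (D 1 1).comp (xiL U), (D 0 0).comp (etaL U), (D 1 0).comp (etaL U),
      (D 0 1).comp (etaL U)]).comp (pointSymmetryAlgebra E U).toSubmodule.subtype
  have hΦ : Function.Injective Φ := by
    refine (injective_iff_map_eq_zero Φ).2 fun X hX => ?_
    have hsym : IsPointSymmetry E U X.1.1 := X.2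
    have x00 : D 0 0 (xiL U X.1) = 0 := congrFun hX 0
    have x10 : D 1 0 (xiL U X.1) = 0 := congrFun hX 1
    have x01 : D 0 1 (xiL U X.1) = 0 := congrFun hX 2
    have x20 : D 2 0 (xiL U X.1) = 0 := congrFun hX 3
    have x11 : D 1 1 (xiL U X.1) = 0 := congrFun hX 4
    have e00 : D 0 0 (etaL U X.1) = 0 := congrFun hX 5
    have e10 : D 1 0 (etaL U X.1) = 0 := congrFun hX 6
    have e01 : D 0 1 (etaL U X.1) = 0 := congrFun hX 7
    have h2 : VanishesToOrder 2 X.1.1 (jetBase j) := by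
      refine (vanishesToOrder_iff_partialAt_xi_eta hjU _ _).2 fun a c hac => ?_
      have : (a = 0 ∧ c = 0) ∨ (a = 1 ∧ c = 0) ∨ (a = 0 ∧ c = 1) := by omega
      rcases this with ⟨rfl, rfl⟩ | ⟨rfl, rfl⟩ | ⟨rfl, rfl⟩
      exacts [⟨x00, e00⟩, ⟨x10, e10⟩, ⟨x01, e01⟩]
    -- At r = n = 2 only l = 0 is available: η_xx = 0, 2η_xy = ξ_xx, η_yy = 2ξ_xy and ξ_yy = 0 at
    -- the base point.
    obtain ⟨e20, hrel⟩ := hsym.partialAt_relations le_rfl hjU hj (l := 0) le_rfl h2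
    have e11 : 2 * D 1 1 (etaL U X.1) = 1 * D 2 0 (xiL U X.1) := by
      simpa using hrel 0 (by omega)
    have e02 : 1 * D 0 2 (etaL U X.1) = 2 * D 1 1 (xiL U X.1) := by
      simpa using hrel 1 (by omega)
    have x02 : 0 = D 0 2 (xiL U X.1) := by
      simpa [Nat.choose] using hrel 2 le_rfl
    rw [x20] at e11
    rw [x11] at e02
    refine Subtype.ext (hsym.eq_zero le_rfl hU hjU hj
      ((vanishesToOrder_iff_partialAt_xi_eta hjU _ _).2 fun a c hac => ?_))
    rcases Nat.lt_or_ge (a + c) 2 with h | h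
    · exact (vanishesToOrder_iff_partialAt_xi_eta hjU _ _).1 h2 a c h
    · have : (a = 2 ∧ c = 0) ∨ (a = 1 ∧ c = 1) ∨ (a = 0 ∧ c = 2) := by omega
      rcases this with ⟨rfl, rfl⟩ | ⟨rfl, rfl⟩ | ⟨rfl, rfl⟩
      exacts [⟨x20, e20⟩, ⟨x11, by simpa using e11⟩, ⟨x02.symm, by simpa using e02⟩]
  simpa using LinearMap.finrank_le_finrank_of_injective hΦ

end Finiteness

end

theorem theorem1 (n : ℕ) (hn : 2 ≤ n) (E : ScalarODE n)
    (U : TopologicalSpace.Opens (ℂ × ℂ)) (hU : IsPreconnected (U : Set (ℂ × ℂ)))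
    (hne : ∃ j : Jet n, jetBase j ∈ U ∧ jetLower j ∈ E.dom) :
    FiniteDimensional ℂ (pointSymmetryAlgebra E U) ∧
      (n = 2 → Module.finrank ℂ (pointSymmetryAlgebra E U) ≤ 8) := by
  obtain ⟨j, hjU, hj⟩ := hne
  refine ⟨finiteDimensional_pointSymmetryAlgebra hn E hU hjU hj, ?_⟩
  rintro rfl
  exact finrank_pointSymmetryAlgebra_two_le E hU hjU hj
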